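/- For a linear ordering $L$ let $s(x)$ be the immediate successor of $x$ if it exists and $s(x)=x$ otherwise, and let $p(x)$ be the immediate predecessor of $x$ if it exists and $p(x)=x$ otherwise. Call $L$ \emph{sp-homogeneous} if every isomorphism between finitely generated substructures of $(L,\le,s,p)$ extends to an automorphism of $(L,\le,s,p)$, and \emph{weakly sp-homogeneous} if there is a finite set $E\subseteq L$ such that every isomorphism between finitely generated substructures of $(L,\le,s,p)$ that is defined on $E$ and fixes every element of $E$ extends to an automorphism of $(L,\le,s,p)$. Let $\varphi_e$ be the $e$-th partial computable function. If $\varphi_e$ is total and is the characteristic function of (the set of codes of pairs in) a linear ordering relation $\le$ on $\omega$, let $L_e$ be the linear ordering $(\omega,\le)$; otherwise $L_e$ is undefined. Then: 1. $\{e : L_e \text{ is defined and sp-homogeneous}\}$ is $\Pi^0_5$-complete. 2. $\{e : L_e \text{ is defined and weakly sp-homogeneous}\}$ is $\Sigma^0_6$-complete. Here a set of natural numbers is complete for a class $\Gamma$ if it belongs to $\Gamma$ and every set in $\Gamma$ is many-one reducible to it. -/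

import Mathlib

open FirstOrder

noncomputable section

/-! ### Linear orderings with successor and predecessor functions -/

/-- Function symbols: the unary symbols `s` and `p`. -/
inductive SpFunc : ℕ → Type
  | s : SpFunc 1
  | p : SpFunc 1

/-- The language with one binary relation symbol `≤` and two unary function symbols `s`, `p`. -/
def spLang : Language := ⟨SpFunc, Language.orderRel⟩

open Classical in
/-- The immediate successor of `x` if it exists, and `x` otherwise. -/
def spSucc {α : Type*} [LinearOrder α] (x : α) : α :=
  if h : ∃ y, x ⋖ y then h.choose else x

open Classical in
/-- The immediate predecessor of `x` if it exists, and `x` otherwise. -/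
def spPred {α : Type*} [LinearOrder α] (x : α) : α :=
  if h : ∃ y, y ⋖ x then h.choose else x

/-- A linear ordering as a structure `(α, ≤, s, p)`. This is not an instance, because a
substructure carries the restrictions of the ambient `s` and `p`, and not the functions computed
from the induced ordering. -/
abbrev spStructure (α : Type*) [LinearOrder α] : spLang.Structure α where
  funMap
    | SpFunc.s, v => spSucc (v 0)
    | SpFunc.p, v => spPred (v 0)
  RelMap
    | Language.orderRel.le, v => v 0 ≤ v 1

/-- A structure is weakly homogeneous if there is a finite set `E` of elements such that every
isomorphism between finitely generated substructures (equivalently, every embedding of a finitely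
generated substructure `S` into the structure) which is defined on `E` and fixes each element of
`E` extends to an automorphism. -/
def IsWeaklyHomogeneous (L : Language) (M : Type*) [L.Structure M] : Prop :=
  ∃ E : Finset M, ∀ S : L.Substructure M, S.FG → ∀ f : S ↪[L] M,
    (∀ a ∈ E, ∃ h : a ∈ S, f ⟨a, h⟩ = a) →
      ∃ g : M ≃[L] M, f = g.toEmbedding.comp S.subtype

/-- `α` is sp-homogeneous if `(α, ≤, s, p)` is homogeneous: every isomorphism between finitely
generated substructures extends to an automorphism. -/
def IsSpHomogeneous (α : Type*) [LinearOrder α] : Prop :=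
  @Language.IsUltrahomogeneous spLang α (spStructure α)

/-- `α` is weakly sp-homogeneous if `(α, ≤, s, p)` is weakly homogeneous. -/
def IsWeaklySpHomogeneous (α : Type*) [LinearOrder α] : Prop :=
  @IsWeaklyHomogeneous spLang α (spStructure α)

/-! ### Indices of computable linear orderings -/

/-- The `e`-th partial computable function. -/
def phi (e : ℕ) : ℕ →. ℕ :=
  (Denumerable.ofNat Nat.Partrec.Code e).eval

open Classical in
/-- `φ_e` is total and is the characteristic function of the ordering relation `≤` of the linear
ordering `o` with domain `ℕ`. -/
def DefinesLinearOrder (e : ℕ) (o : LinearOrder ℕ) : Prop :=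
  ∀ x y : ℕ, phi e (Nat.pair x y) = Part.some (if o.le x y then 1 else 0)

/-- Indices `e` such that `φ_e` defines a linear ordering `L_e` which is sp-homogeneous. -/
def spHomogeneousIndices : Set ℕ :=
  {e | ∃ o : LinearOrder ℕ, DefinesLinearOrder e o ∧ @IsSpHomogeneous ℕ o}

/-- Indices `e` such that `φ_e` defines a linear ordering `L_e` which is weakly sp-homogeneous. -/
def weaklySpHomogeneousIndices : Set ℕ :=
  {e | ∃ o : LinearOrder ℕ, DefinesLinearOrder e o ∧ @IsWeaklySpHomogeneous ℕ o}

/-! ### The arithmetical hierarchy -/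

/-- `A` is `Σ⁰ₙ`: the computable sets for `n = 0`, and the projections of complements of `Σ⁰ₙ`
sets (that is, of `Π⁰ₙ` sets) for `n + 1`. -/
def IsSigmaZero : ℕ → Set ℕ → Prop
  | 0, A => ComputablePred fun x => x ∈ A
  | n + 1, A => ∃ B : Set ℕ, IsSigmaZero n Bᶜ ∧ A = {x | ∃ y, Nat.pair x y ∈ B}

/-- `A` is `Π⁰ₙ`: its complement is `Σ⁰ₙ`. -/
def IsPiZero (n : ℕ) (A : Set ℕ) : Prop :=
  IsSigmaZero n Aᶜ

/-- `A` is complete for a class `Γ` of sets of natural numbers: it belongs to `Γ`, and every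
member of `Γ` is many-one reducible to it by a total computable function. -/
def IsCompleteFor (Γ : Set ℕ → Prop) (A : Set ℕ) : Prop :=
  Γ A ∧ ∀ B : Set ℕ, Γ B → (fun x => x ∈ B) ≤₀ (fun x => x ∈ A)

end

/-!
By back-and-forth, a countable linear ordering is homogeneous over a finite set `E` iff each finite
partial isomorphism fixing `E` extends to any further point. The relations `y = s(x)` and
`y = p(x)` are `Π⁰₂`, so comparing values of words in `s` and `p` is `Δ⁰₃`, being a partial
isomorphism is `Π⁰₃`, the extension property is `Π⁰₅`, and its validity over some finite `E` is
`Σ⁰₆`.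

For hardness, let `T(i) ⇔ ∃ m, ∀ j, ∃ y, ¬ R i m j y` be `Σ⁰₄`. We order words lexicographically
over the letters `(q, j)`, where `q` is an element of a coloured computable dense order divided into
consecutive intervals, one for each `i`, and `j` is the place of the letter. A letter of colour `m`
at place `j` in the interval of `i` may be followed by every word if `∀ y, R i m j' y` for some
`j' ≤ j`, and by finitely many words otherwise. If `m` witnesses `T(i)`, then the letters at all
the places `j` lie in one block of type `ω`; if no `m` does, every `ω` block breaks up and only
finite blocks remain. Other colours put finite blocks of every size densely everywhere, so the
interval of `i` is a shuffle whose blocks include those of type `ω` iff `T(i)`. If `T(i)` holds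
infinitely often, the ordering is therefore sp-homogeneous iff `T(i)` for all `i`, and weakly
sp-homogeneous iff `T(i)` for almost all `i`: then it suffices to fix finitely many points that
separate the exceptional intervals.

Each `Π⁰₅` set has the form `{x | ∀ i, T(x, i)}`. A `Σ⁰₆` predicate `∃ t, ∀ b, ¬ P t b` with `P` in
`Π⁰₄` and unique witnesses `b` says that the set of lists of witnesses for an initial segment of
the numbers `t` is finite, so each `Σ⁰₆` set has the form `{x | T(x, i) for almost all i}`.
-/

universe u v

/-! ### Computable functions and predicates -/

section Computability

variable {α β γ : Type*} [Primcodable α] [Primcodable β] [Primcodable γ]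

attribute [fun_prop] Computable
attribute [fun_prop] Computable.id Computable.const Computable.comp Computable.pair

@[fun_prop]
lemma computable_fst_comp {f : α → β × γ} (h : Computable f) : Computable fun a ↦ (f a).1 :=
  Computable.fst.comp h

@[fun_prop]
lemma computable_snd_comp {f : α → β × γ} (h : Computable f) : Computable fun a ↦ (f a).2 :=
  Computable.snd.comp h

@[fun_prop]
lemma computable_getD_comp {f : α → List β} {g : α → ℕ} (hf : Computable f) (hg : Computable g)
    (d : β) : Computable fun a ↦ (f a).getD (g a) d :=
  (Primrec.list_getD d).to_comp.comp hf hg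

@[fun_prop]
lemma computable_length_comp {f : α → List β} (hf : Computable f) :
    Computable fun a ↦ (f a).length :=
  Primrec.list_length.to_comp.comp hf

@[fun_prop]
lemma computable_cons_comp {f : α → β} {g : α → List β} (hf : Computable f) (hg : Computable g) :
    Computable fun a ↦ f a :: g a :=
  Primrec.list_cons.to_comp.comp hf hg

@[fun_prop]
lemma computable_add_comp {f g : α → ℕ} (hf : Computable f) (hg : Computable g) :
    Computable fun a ↦ f a + g a :=
  Primrec.nat_add.to_comp.comp hf hg

@[fun_prop]
lemma computable_natPair_comp {f g : α → ℕ} (hf : Computable f) (hg : Computable g) :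
    Computable fun a ↦ Nat.pair (f a) (g a) :=
  Primrec₂.natPair.to_comp.comp hf hg

@[fun_prop]
lemma computable_natUnpair_comp {f : α → ℕ} (hf : Computable f) :
    Computable fun a ↦ (f a).unpair :=
  Primrec.unpair.to_comp.comp hf

lemma computablePred_iff_exists_bool {p : α → Prop} :
    ComputablePred p ↔ ∃ f : α → Bool, Computable f ∧ ∀ a, p a ↔ f a = true := by
  constructor
  · rintro ⟨_, h⟩
    exact ⟨_, h, fun a ↦ by simp⟩
  · rintro ⟨f, hf, h⟩
    refine ⟨fun a ↦ decidable_of_iff _ (h a).symm, hf.of_eq fun a ↦ ?_⟩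
    rw [Bool.eq_iff_iff]
    simp [h]

variable {p q : α → Prop}

lemma computablePred_comp {p : β → Prop} (hp : ComputablePred p) {f : α → β} (hf : Computable f) :
    ComputablePred fun a ↦ p (f a) := by
  obtain ⟨g, hg, hgp⟩ := computablePred_iff_exists_bool.1 hp
  exact computablePred_iff_exists_bool.2 ⟨_, hg.comp hf, fun a ↦ hgp _⟩

lemma computablePred_and (hp : ComputablePred p) (hq : ComputablePred q) :
    ComputablePred fun a ↦ p a ∧ q a := by
  obtain ⟨f, hf, hfp⟩ := computablePred_iff_exists_bool.1 hp
  obtain ⟨g, hg, hgq⟩ := computablePred_iff_exists_bool.1 hq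
  exact computablePred_iff_exists_bool.2
    ⟨_, Primrec.and.to_comp.comp hf hg, by simp [hfp, hgq]⟩

lemma computablePred_or (hp : ComputablePred p) (hq : ComputablePred q) :
    ComputablePred fun a ↦ p a ∨ q a := by
  obtain ⟨f, hf, hfp⟩ := computablePred_iff_exists_bool.1 hp
  obtain ⟨g, hg, hgq⟩ := computablePred_iff_exists_bool.1 hq
  exact computablePred_iff_exists_bool.2
    ⟨_, Primrec.or.to_comp.comp hf hg, by simp [hfp, hgq]⟩

lemma computablePred_eq {f g : α → β} (hf : Computable f) (hg : Computable g) :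
    ComputablePred fun a ↦ f a = g a := by
  classical
  exact computablePred_comp (Primrec.eq (α := β)).computablePred (hf.pair hg)

lemma computablePred_lt {f g : α → ℕ} (hf : Computable f) (hg : Computable g) :
    ComputablePred fun a ↦ f a < g a :=
  computablePred_comp (p := fun x : ℕ × ℕ ↦ x.1 < x.2) Primrec.nat_lt.computablePred (hf.pair hg)

lemma computablePred_le {f g : α → ℕ} (hf : Computable f) (hg : Computable g) :
    ComputablePred fun a ↦ f a ≤ g a :=
  computablePred_comp (p := fun x : ℕ × ℕ ↦ x.1 ≤ x.2) Primrec.nat_le.computablePred (hf.pair hg)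

lemma computablePred_mem {f : α → β} {l : α → List β} (hf : Computable f) (hl : Computable l) :
    ComputablePred fun a ↦ f a ∈ l a := by
  classical
  simp only [← List.idxOf_lt_length_iff]
  exact computablePred_lt (Primrec.list_idxOf.to_comp.comp hf hl) (by fun_prop)

lemma computablePred_ball_lt {p : α → ℕ → Prop}
    (hp : ComputablePred fun x : α × ℕ ↦ p x.1 x.2) :
    ComputablePred fun x : α × ℕ ↦ ∀ t < x.2, p x.1 t := by
  obtain ⟨f, hf, hfp⟩ := computablePred_iff_exists_bool.1 hp
  have hrec := Computable.nat_rec (f := fun x : α × ℕ ↦ x.2) (g := fun _ ↦ true)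
    (h := fun x y ↦ y.2 && f (x.1, y.1)) (by fun_prop) (by fun_prop)
    (Primrec.and.to_comp.comp (by fun_prop) (hf.comp (by fun_prop)))
  refine computablePred_iff_exists_bool.2 ⟨_, hrec, ?_⟩
  rintro ⟨a, k⟩
  induction k with
  | zero => simp
  | succ k ih =>
    simp only [Nat.forall_lt_succ_right, Bool.and_eq_true] at ih ⊢
    exact and_congr ih (hfp (a, k))

end Computability

/-! ### Arithmetical predicates -/

/-- `Σ⁰ₙ` predicates on a `Primcodable` type. -/
def SigmaPred : ℕ → ∀ {α : Type u} [Primcodable α], (α → Prop) → Prop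
  | 0, _, _, p => ComputablePred p
  | n + 1, α, _, p => ∃ q : α × ℕ → Prop, SigmaPred n (fun x ↦ ¬ q x) ∧ ∀ x, p x ↔ ∃ y, q (x, y)

/-- `Π⁰ₙ` predicates on a `Primcodable` type. -/
def PiPred (n : ℕ) {α : Type u} [Primcodable α] (p : α → Prop) : Prop :=
  SigmaPred n fun x ↦ ¬ p x

section ArithmeticalHierarchy

variable {α : Type u} {β : Type v} [Primcodable α] [Primcodable β] {n m : ℕ} {p q : α → Prop}

lemma SigmaPred.of_iff (hp : SigmaPred n p) (h : ∀ x, q x ↔ p x) : SigmaPred n q := by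
  rwa [funext fun x ↦ propext (h x)]

lemma PiPred.of_iff (hp : PiPred n p) (h : ∀ x, q x ↔ p x) : PiPred n q :=
  SigmaPred.of_iff hp fun x ↦ not_congr (h x)

lemma SigmaPred.not (hp : PiPred n p) : SigmaPred n fun x ↦ ¬ p x := hp

lemma PiPred.not (hp : SigmaPred n p) : PiPred n fun x ↦ ¬ p x :=
  hp.of_iff fun _ ↦ not_not

lemma SigmaPred.comp {p : β → Prop} (hp : SigmaPred n p) {f : α → β} (hf : Computable f) :
    SigmaPred n fun a ↦ p (f a) := by
  induction n generalizing α β with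
  | zero => exact computablePred_comp hp hf
  | succ n ih =>
    obtain ⟨q, hq, hpq⟩ := hp
    exact ⟨fun x ↦ q (f x.1, x.2), ih hq (by fun_prop), fun x ↦ hpq _⟩

lemma PiPred.comp {p : β → Prop} (hp : PiPred n p) {f : α → β} (hf : Computable f) :
    PiPred n fun a ↦ p (f a) :=
  SigmaPred.comp (p := fun x ↦ ¬ p x) hp hf

lemma PiPred.toSigma_succ (hp : PiPred n p) : SigmaPred (n + 1) p :=
  ⟨fun x ↦ p x.1, hp.comp Computable.fst, fun _ ↦ (exists_const ℕ).symm⟩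

lemma SigmaPred.succ (hp : SigmaPred n p) : SigmaPred (n + 1) p := by
  induction n generalizing α with
  | zero => exact PiPred.toSigma_succ (ComputablePred.not hp)
  | succ n ih =>
    obtain ⟨q, hq, hpq⟩ := hp
    exact ⟨q, ih hq, hpq⟩

lemma SigmaPred.mono (hp : SigmaPred n p) (hnm : n ≤ m) : SigmaPred m p := by
  induction hnm with
  | refl => exact hp
  | step _ ih => exact ih.succ

lemma PiPred.mono (hp : PiPred n p) (hnm : n ≤ m) : PiPred m p := SigmaPred.mono hp hnm

lemma PiPred.toSigma (hp : PiPred n p) (hnm : n < m) : SigmaPred m p := hp.toSigma_succ.mono hnm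

lemma SigmaPred.toPi (hp : SigmaPred n p) (hnm : n < m) : PiPred m p :=
  (PiPred.not hp).toSigma hnm

lemma SigmaPred.of_computable (hp : ComputablePred p) : SigmaPred n p :=
  SigmaPred.mono (n := 0) hp n.zero_le

lemma PiPred.of_computable (hp : ComputablePred p) : PiPred n p :=
  SigmaPred.of_computable hp.not

lemma piPred_zero_iff : PiPred 0 p ↔ ComputablePred p :=
  ⟨fun hp ↦ SigmaPred.of_iff (n := 0) (ComputablePred.not hp) fun _ ↦ not_not.symm, .of_computable⟩

lemma exists_exists_nat_iff {P : ℕ → ℕ → Prop} :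
    (∃ a b, P a b) ↔ ∃ y : ℕ, P y.unpair.1 y.unpair.2 :=
  Prod.exists'.symm.trans Nat.pairEquiv.symm.surjective.exists

lemma SigmaPred.and_or (hp : SigmaPred n p) (hq : SigmaPred n q) :
    SigmaPred n (fun x ↦ p x ∧ q x) ∧ SigmaPred n fun x ↦ p x ∨ q x := by
  induction n generalizing α with
  | zero => exact ⟨computablePred_and hp hq, computablePred_or hp hq⟩
  | succ n ih =>
    obtain ⟨r, hr, hpr⟩ := hp
    obtain ⟨s, hs, hqs⟩ := hq
    constructor
    · refine ⟨fun x ↦ r (x.1, x.2.unpair.1) ∧ s (x.1, x.2.unpair.2), ?_, fun x ↦ ?_⟩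
      · exact (ih (hr.comp (f := fun x : α × ℕ ↦ (x.1, x.2.unpair.1)) (by fun_prop))
          (hs.comp (f := fun x : α × ℕ ↦ (x.1, x.2.unpair.2)) (by fun_prop))).2.of_iff
            fun x ↦ not_and_or
      · change p x ∧ q x ↔ _
        rw [hpr, hqs, exists_and_exists_comm]
        exact exists_exists_nat_iff (P := fun a b ↦ r (x, a) ∧ s (x, b))
    · refine ⟨fun x ↦ r x ∨ s x, (ih hr hs).1.of_iff fun x ↦ not_or, fun x ↦ ?_⟩
      change p x ∨ q x ↔ _
      rw [hpr, hqs, exists_or]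

lemma SigmaPred.and (hp : SigmaPred n p) (hq : SigmaPred n q) : SigmaPred n fun x ↦ p x ∧ q x :=
  (hp.and_or hq).1

lemma SigmaPred.or (hp : SigmaPred n p) (hq : SigmaPred n q) : SigmaPred n fun x ↦ p x ∨ q x :=
  (hp.and_or hq).2

lemma PiPred.and (hp : PiPred n p) (hq : PiPred n q) : PiPred n fun x ↦ p x ∧ q x :=
  (SigmaPred.or hp hq).of_iff fun _ ↦ not_and_or

lemma PiPred.or (hp : PiPred n p) (hq : PiPred n q) : PiPred n fun x ↦ p x ∨ q x :=
  (SigmaPred.and hp hq).of_iff fun _ ↦ not_or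

lemma PiPred.imp (hp : SigmaPred n p) (hq : PiPred n q) : PiPred n fun x ↦ p x → q x :=
  ((PiPred.not hp).or hq).of_iff fun _ ↦ imp_iff_not_or

lemma SigmaPred.exists_nat {p : α → ℕ → Prop}
    (hp : SigmaPred (n + 1) fun x : α × ℕ ↦ p x.1 x.2) :
    SigmaPred (n + 1) fun a ↦ ∃ y, p a y := by
  obtain ⟨q, hq, hpq⟩ := hp
  refine ⟨fun x ↦ q ((x.1, x.2.unpair.1), x.2.unpair.2),
    hq.comp (f := fun x : α × ℕ ↦ ((x.1, x.2.unpair.1), x.2.unpair.2)) (by fun_prop),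
    fun a ↦ ?_⟩
  change (∃ y, p a y) ↔ _
  rw [exists_congr fun y ↦ hpq (a, y)]
  exact exists_exists_nat_iff (P := fun y z ↦ q ((a, y), z))

lemma SigmaPred.exists [Inhabited β] {p : α → β → Prop}
    (hp : SigmaPred (n + 1) fun x : α × β ↦ p x.1 x.2) : SigmaPred (n + 1) fun a ↦ ∃ b, p a b := by
  have hd : Computable fun x : α × ℕ ↦ (Encodable.decode (α := β) x.2).getD default :=
    Primrec.option_getD_default.to_comp.comp (Computable.decode.comp Computable.snd)
  refine (SigmaPred.exists_nat (p := fun a y ↦ p a ((Encodable.decode y).getD default))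
    (hp.comp (Computable.fst.pair hd))).of_iff fun a ↦ ⟨?_, fun ⟨y, hy⟩ ↦ ⟨_, hy⟩⟩
  rintro ⟨b, hb⟩
  exact ⟨Encodable.encode b, by simpa using hb⟩

lemma PiPred.forall [Inhabited β] {p : α → β → Prop}
    (hp : PiPred (n + 1) fun x : α × β ↦ p x.1 x.2) : PiPred (n + 1) fun a ↦ ∀ b, p a b :=
  (SigmaPred.exists (p := fun a b ↦ ¬ p a b) hp).of_iff fun _ ↦ not_forall

lemma SigmaPred.ball_lt {p : α → ℕ → Prop} (hp : SigmaPred 1 fun x : α × ℕ ↦ p x.1 x.2) :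
    SigmaPred 1 fun x : α × ℕ ↦ ∀ t < x.2, p x.1 t := by
  obtain ⟨q, hq, hpq⟩ := hp
  have hball : ComputablePred fun y : (α × ℕ) × List ℕ ↦
      ∀ t < y.1.2, q ((y.1.1, t), y.2.getD t 0) :=
    computablePred_comp (f := fun y : (α × ℕ) × List ℕ ↦ ((y.1.1, y.2), y.1.2))
      (computablePred_ball_lt (p := fun (y : α × List ℕ) t ↦ q ((y.1, t), y.2.getD t 0))
        (computablePred_comp (f := fun y : (α × List ℕ) × ℕ ↦ ((y.1.1, y.2), y.1.2.getD y.2 0))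
          (piPred_zero_iff.1 hq) (by fun_prop))) (by fun_prop)
  refine (SigmaPred.exists (n := 0) (p := fun (x : α × ℕ) (l : List ℕ) ↦
    ∀ t < x.2, q ((x.1, t), l.getD t 0)) (.of_computable hball)).of_iff ?_
  rintro ⟨a, k⟩
  constructor
  · intro H
    choose! f hf using fun t ht ↦ (hpq (a, t)).1 (H t ht)
    refine ⟨(List.range k).map f, fun t ht ↦ ?_⟩
    simpa [List.getD, ht] using hf t ht
  · rintro ⟨l, hl⟩ t ht
    exact (hpq (a, t)).2 ⟨_, hl t ht⟩

lemma isSigmaZero_iff {A : Set ℕ} : IsSigmaZero n A ↔ SigmaPred n fun x ↦ x ∈ A := by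
  induction n generalizing A with
  | zero => rfl
  | succ n ih =>
    constructor
    · rintro ⟨B, hB, rfl⟩
      exact ⟨fun x ↦ Nat.pair x.1 x.2 ∈ B, SigmaPred.comp (ih.1 hB) Primrec₂.natPair.to_comp,
        fun x ↦ Iff.rfl⟩
    · rintro ⟨q, hq, hAq⟩
      refine ⟨{x | q x.unpair}, ih.2 (SigmaPred.comp hq Primrec.unpair.to_comp), ?_⟩
      ext x
      simpa using hAq x

lemma isPiZero_iff {A : Set ℕ} : IsPiZero n A ↔ PiPred n fun x ↦ x ∈ A :=
  isSigmaZero_iff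

end ArithmeticalHierarchy

/-- `p` agrees with a `Σ⁰ₙ` predicate wherever the promise `D` holds. This lets complexity bounds
for `L_e` be computed as if `L_e` were always defined. -/
def SigmaPredOn (n : ℕ) {α : Type u} [Primcodable α] (D p : α → Prop) : Prop :=
  ∃ q : α → Prop, SigmaPred n q ∧ ∀ x, D x → (p x ↔ q x)

/-- `p` agrees with a `Π⁰ₙ` predicate wherever the promise `D` holds. -/
def PiPredOn (n : ℕ) {α : Type u} [Primcodable α] (D p : α → Prop) : Prop :=
  SigmaPredOn n D fun x ↦ ¬ p x

section Promise

variable {α : Type u} {β : Type v} [Primcodable α] [Primcodable β] {n m : ℕ} {D p q : α → Prop}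

lemma SigmaPredOn.of_iff (hp : SigmaPredOn n D p) (h : ∀ x, D x → (q x ↔ p x)) :
    SigmaPredOn n D q :=
  let ⟨r, hr, hpr⟩ := hp
  ⟨r, hr, fun x hx ↦ (h x hx).trans (hpr x hx)⟩

lemma PiPredOn.of_iff (hp : PiPredOn n D p) (h : ∀ x, D x → (q x ↔ p x)) : PiPredOn n D q :=
  SigmaPredOn.of_iff hp fun x hx ↦ not_congr (h x hx)

lemma piPredOn_iff : PiPredOn n D p ↔ ∃ q : α → Prop, PiPred n q ∧ ∀ x, D x → (p x ↔ q x) :=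
  ⟨fun ⟨q, hq, hpq⟩ ↦ ⟨fun x ↦ ¬ q x, .not hq, fun x hx ↦ by simp [← hpq x hx]⟩,
    fun ⟨q, hq, hpq⟩ ↦ ⟨fun x ↦ ¬ q x, hq, fun x hx ↦ not_congr (hpq x hx)⟩⟩

lemma PiPredOn.not (hp : SigmaPredOn n D p) : PiPredOn n D fun x ↦ ¬ p x :=
  hp.of_iff fun _ _ ↦ not_not

lemma SigmaPredOn.of_computable (hp : ComputablePred p) : SigmaPredOn n D p :=
  ⟨p, .of_computable hp, fun _ _ ↦ Iff.rfl⟩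

lemma PiPredOn.of_computable (hp : ComputablePred p) : PiPredOn n D p :=
  SigmaPredOn.of_computable hp.not

lemma SigmaPredOn.mono (hp : SigmaPredOn n D p) (hnm : n ≤ m) : SigmaPredOn m D p :=
  let ⟨q, hq, hpq⟩ := hp
  ⟨q, hq.mono hnm, hpq⟩

lemma PiPredOn.mono (hp : PiPredOn n D p) (hnm : n ≤ m) : PiPredOn m D p :=
  SigmaPredOn.mono hp hnm

lemma PiPredOn.toSigma (hp : PiPredOn n D p) (hnm : n < m) : SigmaPredOn m D p :=
  let ⟨q, hq, hpq⟩ := piPredOn_iff.1 hp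
  ⟨q, hq.toSigma hnm, hpq⟩

lemma SigmaPredOn.toPi (hp : SigmaPredOn n D p) (hnm : n < m) : PiPredOn m D p :=
  (PiPredOn.not hp).toSigma hnm

lemma SigmaPredOn.and (hp : SigmaPredOn n D p) (hq : SigmaPredOn n D q) :
    SigmaPredOn n D fun x ↦ p x ∧ q x :=
  let ⟨_, hr, hpr⟩ := hp
  let ⟨_, hs, hqs⟩ := hq
  ⟨_, hr.and hs, fun x hx ↦ and_congr (hpr x hx) (hqs x hx)⟩

lemma SigmaPredOn.or (hp : SigmaPredOn n D p) (hq : SigmaPredOn n D q) :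
    SigmaPredOn n D fun x ↦ p x ∨ q x :=
  let ⟨_, hr, hpr⟩ := hp
  let ⟨_, hs, hqs⟩ := hq
  ⟨_, hr.or hs, fun x hx ↦ or_congr (hpr x hx) (hqs x hx)⟩

lemma PiPredOn.and (hp : PiPredOn n D p) (hq : PiPredOn n D q) :
    PiPredOn n D fun x ↦ p x ∧ q x :=
  (SigmaPredOn.or hp hq).of_iff fun _ _ ↦ not_and_or

lemma PiPredOn.or (hp : PiPredOn n D p) (hq : PiPredOn n D q) :
    PiPredOn n D fun x ↦ p x ∨ q x :=
  (SigmaPredOn.and hp hq).of_iff fun _ _ ↦ not_or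

lemma SigmaPredOn.imp (hp : PiPredOn n D p) (hq : SigmaPredOn n D q) :
    SigmaPredOn n D fun x ↦ p x → q x :=
  (SigmaPredOn.or hp hq).of_iff fun _ _ ↦ imp_iff_not_or

lemma PiPredOn.imp (hp : SigmaPredOn n D p) (hq : PiPredOn n D q) :
    PiPredOn n D fun x ↦ p x → q x :=
  ((PiPredOn.not hp).or hq).of_iff fun _ _ ↦ imp_iff_not_or

lemma SigmaPredOn.exists [Inhabited β] {p : α → β → Prop}
    (hp : SigmaPredOn (n + 1) (fun x : α × β ↦ D x.1) fun x ↦ p x.1 x.2) :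
    SigmaPredOn (n + 1) D fun a ↦ ∃ b, p a b :=
  let ⟨q, hq, hpq⟩ := hp
  ⟨fun a ↦ ∃ b, q (a, b), .exists hq, fun a ha ↦ exists_congr fun b ↦ hpq (a, b) ha⟩

lemma PiPredOn.forall [Inhabited β] {p : α → β → Prop}
    (hp : PiPredOn (n + 1) (fun x : α × β ↦ D x.1) fun x ↦ p x.1 x.2) :
    PiPredOn (n + 1) D fun a ↦ ∀ b, p a b :=
  (SigmaPredOn.exists (p := fun a b ↦ ¬ p a b) hp).of_iff fun _ _ ↦ not_forall

lemma SigmaPredOn.and_promise (hp : SigmaPredOn n D p) (hD : SigmaPred n D) :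
    SigmaPred n fun x ↦ D x ∧ p x :=
  let ⟨_, hq, hpq⟩ := hp
  (hD.and hq).of_iff fun x ↦ and_congr_right (hpq x)

lemma PiPredOn.and_promise (hp : PiPredOn n D p) (hD : PiPred n D) :
    PiPred n fun x ↦ D x ∧ p x :=
  let ⟨_, hq, hpq⟩ := piPredOn_iff.1 hp
  (hD.and hq).of_iff fun x ↦ and_congr_right (hpq x)

end Promise

/-! ### The functions `s` and `p` -/

section SuccPred

variable {α β : Type*} [LinearOrder α] [LinearOrder β]

lemma spSucc_eq_of_covBy {x y : α} (h : x ⋖ y) : spSucc x = y := by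
  have hx : ∃ y, x ⋖ y := ⟨y, h⟩
  rw [spSucc, dif_pos hx]
  exact hx.choose_spec.unique_right h

lemma spSucc_eq_self {x : α} (h : ¬ ∃ y, x ⋖ y) : spSucc x = x := dif_neg h

lemma spSucc_eq_iff {x y : α} : spSucc x = y ↔ x ⋖ y ∨ x = y ∧ ∀ z, ¬ x ⋖ z := by
  by_cases hx : ∃ z, x ⋖ z
  · obtain ⟨z, hz⟩ := hx
    rw [spSucc_eq_of_covBy hz]
    exact ⟨fun h ↦ .inl (h ▸ hz), fun h ↦ h.elim hz.unique_right fun h ↦ absurd hz (h.2 z)⟩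
  · rw [spSucc_eq_self hx]
    exact ⟨fun h ↦ .inr ⟨h, not_exists.1 hx⟩, fun h ↦ h.elim (fun h ↦ absurd ⟨y, h⟩ hx) And.left⟩

lemma toDual_spPred (x : α) : OrderDual.toDual (spPred x) = spSucc (OrderDual.toDual x) := by
  symm
  rw [spSucc_eq_iff]
  by_cases hx : ∃ z, z ⋖ x
  · rw [spPred, dif_pos hx]
    exact .inl hx.choose_spec.toDual
  · rw [spPred, dif_neg hx]
    exact .inr ⟨rfl, fun z hz ↦ hx ⟨_, hz.ofDual⟩⟩

lemma spPred_eq_of_covBy {x y : α} (h : y ⋖ x) : spPred x = y :=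
  OrderDual.toDual.injective <| (toDual_spPred x).trans (spSucc_eq_of_covBy h.toDual)

lemma spPred_eq_iff {x y : α} : spPred x = y ↔ y ⋖ x ∨ x = y ∧ ∀ z, ¬ z ⋖ x := by
  rw [← OrderDual.toDual.injective.eq_iff, toDual_spPred, spSucc_eq_iff]
  exact or_congr toDual_covBy_toDual_iff
    (and_congr Iff.rfl (OrderDual.forall.trans (forall_congr' fun _ ↦
      not_congr toDual_covBy_toDual_iff)))

lemma orderIso_map_spSucc (e : α ≃o β) (x : α) : e (spSucc x) = spSucc (e x) := by
  symm
  rw [spSucc_eq_iff, apply_covBy_apply_iff, e.apply_eq_iff_eq, e.surjective.forall]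
  simpa only [apply_covBy_apply_iff] using spSucc_eq_iff.1 (rfl : spSucc x = _)

lemma orderIso_map_spPred (e : α ≃o β) (x : α) : e (spPred x) = spPred (e x) := by
  apply OrderDual.toDual.injective
  rw [toDual_spPred]
  exact (congrArg e.dual (toDual_spPred x)).trans (orderIso_map_spSucc e.dual _)

/-- One of the functions `s` (`true`) and `p` (`false`). -/
noncomputable def spStep (b : Bool) (x : α) : α := bif b then spSucc x else spPred x

/-- The value at `x` of a word in `s` and `p`, the letters being applied from left to right. -/
noncomputable def spAct (x : α) (w : List Bool) : α := w.foldl (fun y b ↦ spStep b y) x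

lemma spAct_cons (x : α) (b : Bool) (w : List Bool) :
    spAct x (b :: w) = spAct (spStep b x) w := rfl

lemma spAct_append (x : α) (w w' : List Bool) : spAct x (w ++ w') = spAct (spAct x w) w' :=
  List.foldl_append

lemma orderIso_map_spStep (e : α ≃o β) (b : Bool) (x : α) : e (spStep b x) = spStep b (e x) := by
  cases b
  exacts [orderIso_map_spPred e x, orderIso_map_spSucc e x]

lemma orderIso_map_spAct (e : α ≃o β) (x : α) (w : List Bool) :
    e (spAct x w) = spAct (e x) w := by
  induction w generalizing x with
  | nil => rfl
  | cons b w ih => rw [spAct_cons, ih, orderIso_map_spStep, spAct_cons]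

end SuccPred

/-! ### Partial isomorphisms and back-and-forth -/

section PartialIso

variable {α β γ δ : Type*} [LinearOrder α] [LinearOrder β] [LinearOrder γ] [LinearOrder δ]

/-- The relation `r` generates an isomorphism between the substructures of `(α, ≤, s, p)` and
`(β, ≤, s, p)` that are generated by its domain and its range. -/
def IsSpPartialIso (r : Set (α × β)) : Prop :=
  ∀ u ∈ r, ∀ v ∈ r, ∀ w w' : List Bool, spAct u.1 w ≤ spAct v.1 w' ↔ spAct u.2 w ≤ spAct v.2 w'

namespace IsSpPartialIso

variable {r s : Set (α × β)} {u v : α × β}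

lemma mono (hs : IsSpPartialIso s) (h : r ⊆ s) : IsSpPartialIso r :=
  fun u hu v hv ↦ hs u (h hu) v (h hv)

lemma swap (hr : IsSpPartialIso r) : IsSpPartialIso (Prod.swap ⁻¹' r) :=
  fun u hu v hv w w' ↦ (hr u.swap hu v.swap hv w w').symm

lemma spAct_eq_iff (hr : IsSpPartialIso r) (hu : u ∈ r) (hv : v ∈ r) (w w' : List Bool) :
    spAct u.1 w = spAct v.1 w' ↔ spAct u.2 w = spAct v.2 w' := by
  simp only [le_antisymm_iff, hr u hu v hv, hr v hv u hu]

lemma le_iff (hr : IsSpPartialIso r) (hu : u ∈ r) (hv : v ∈ r) : u.1 ≤ v.1 ↔ u.2 ≤ v.2 :=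
  hr u hu v hv [] []

lemma lt_iff (hr : IsSpPartialIso r) (hu : u ∈ r) (hv : v ∈ r) : u.1 < v.1 ↔ u.2 < v.2 :=
  lt_iff_lt_of_le_iff_le (hr.le_iff hv hu)

lemma image_orderIso (hr : IsSpPartialIso r) (e : α ≃o γ) (f : β ≃o δ) :
    IsSpPartialIso (Prod.map e f '' r) := by
  rintro _ ⟨u, hu, rfl⟩ _ ⟨v, hv, rfl⟩ w w'
  simpa only [Prod.map_fst, Prod.map_snd, ← orderIso_map_spAct, OrderIso.le_iff_le] using
    hr u hu v hv w w'

lemma insert_spAct (hr : IsSpPartialIso r) (hu : u ∈ r) (w : List Bool) :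
    IsSpPartialIso (insert (spAct u.1 w, spAct u.2 w) r) := by
  have orbit : ∀ v ∈ insert (spAct u.1 w, spAct u.2 w) r,
      ∃ v' ∈ r, ∃ t, v.1 = spAct v'.1 t ∧ v.2 = spAct v'.2 t := by
    rintro v (rfl | hv)
    exacts [⟨u, hu, w, rfl, rfl⟩, ⟨v, hv, [], rfl, rfl⟩]
  intro a ha b hb t t'
  obtain ⟨a', ha', ta, ha1, ha2⟩ := orbit a ha
  obtain ⟨b', hb', tb, hb1, hb2⟩ := orbit b hb
  rw [ha1, ha2, hb1, hb2]
  simpa only [spAct_append] using hr a' ha' b' hb' (ta ++ t) (tb ++ t')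

end IsSpPartialIso

lemma isSpPartialIso_graph (g : α ≃o β) : IsSpPartialIso {u : α × β | g u.1 = u.2} := by
  intro u (hu : g u.1 = u.2) v (hv : g v.1 = v.2) w w'
  rw [← hu, ← hv, ← orderIso_map_spAct, ← orderIso_map_spAct, g.le_iff_le]

lemma exists_orderIso_of_total {r : Set (α × β)}
    (hr : ∀ u ∈ r, ∀ v ∈ r, u.1 ≤ v.1 ↔ u.2 ≤ v.2) (hleft : ∀ a, ∃ b, (a, b) ∈ r)
    (hright : ∀ b, ∃ a, (a, b) ∈ r) : ∃ g : α ≃o β, ∀ u ∈ r, g u.1 = u.2 := by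
  choose F hF using hleft
  choose G hG using hright
  have heq : ∀ u ∈ r, ∀ v ∈ r, u.1 = v.1 ↔ u.2 = v.2 := fun u hu v hv ↦ by
    rw [le_antisymm_iff, le_antisymm_iff, hr u hu v hv, hr v hv u hu]
  exact ⟨⟨⟨F, G, fun a ↦ (heq _ (hG (F a)) _ (hF a)).2 rfl,
    fun b ↦ (heq _ (hF (G b)) _ (hG b)).1 rfl⟩, (hr _ (hF _) _ (hF _)).symm⟩,
    fun u hu ↦ (heq _ (hF u.1) u hu).1 rfl⟩

/-- The finite partial isomorphisms of `(α, ≤, s, p)`, given by generators, that fix every element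
of `E`. -/
def finiteSpPartialIsos (E : Set α) : Set (Set (α × α)) :=
  {r | r.Finite ∧ (∀ e ∈ E, (e, e) ∈ r) ∧ IsSpPartialIso r}

/-- The one-point extension property: each finite partial isomorphism that fixes `E` extends to
any further element. -/
def HasSpExtension (E : Set α) : Prop :=
  ∀ r ∈ finiteSpPartialIsos E, ∀ c, ∃ d, IsSpPartialIso (insert (c, d) r)

variable {E : Set α} {r : Set (α × α)}

lemma insert_mem_finiteSpPartialIsos {u : α × α} (hr : r ∈ finiteSpPartialIsos E)
    (hu : IsSpPartialIso (insert u r)) : insert u r ∈ finiteSpPartialIsos E :=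
  ⟨hr.1.insert u, fun e he ↦ .inr (hr.2.1 e he), hu⟩

lemma swap_mem_finiteSpPartialIsos (hr : r ∈ finiteSpPartialIsos E) :
    Prod.swap ⁻¹' r ∈ finiteSpPartialIsos E :=
  ⟨hr.1.preimage Prod.swap_injective.injOn, hr.2.1, hr.2.2.swap⟩

lemma image_mem_finiteSpPartialIsos (e : α ≃o β) (hr : r ∈ finiteSpPartialIsos E) :
    Prod.map e e '' r ∈ finiteSpPartialIsos (e '' E) := by
  refine ⟨hr.1.image _, ?_, hr.2.2.image_orderIso e e⟩
  rintro _ ⟨a, ha, rfl⟩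
  exact ⟨(a, a), hr.2.1 a ha, rfl⟩

lemma HasSpExtension.image_orderIso (h : HasSpExtension E) (e : α ≃o β) :
    HasSpExtension (e '' E) := by
  intro r hr c
  have hr' : Prod.map e.symm e.symm '' r ∈ finiteSpPartialIsos E := by
    simpa only [Set.image_image, OrderIso.symm_apply_apply, Set.image_id'] using
      image_mem_finiteSpPartialIsos e.symm hr
  obtain ⟨d, hd⟩ := h _ hr' (e.symm c)
  have hcancel : Prod.map e e '' (Prod.map e.symm e.symm '' r) = r :=
    (e.toEquiv.prodCongr e.toEquiv).image_symm_image r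
  refine ⟨e d, ?_⟩
  simpa only [Set.image_insert_eq, hcancel, Prod.map_apply, OrderIso.apply_symm_apply] using
    hd.image_orderIso e e

lemma HasSpExtension.exists_insert_right (h : HasSpExtension E) (hr : r ∈ finiteSpPartialIsos E)
    (d : α) : ∃ c, IsSpPartialIso (insert (c, d) r) := by
  obtain ⟨c, hc⟩ := h _ (swap_mem_finiteSpPartialIsos hr) d
  refine ⟨c, hc.swap.mono ?_⟩
  rintro u (rfl | hu)
  exacts [.inl rfl, .inr (by simpa using hu)]

lemma HasSpExtension.isCofinal_left (h : HasSpExtension E) (c : α) :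
    IsCofinal {r : finiteSpPartialIsos E | ∃ d, (c, d) ∈ r.1} := by
  rintro ⟨r, hr⟩
  obtain ⟨d, hd⟩ := h r hr c
  exact ⟨⟨_, insert_mem_finiteSpPartialIsos hr hd⟩, ⟨d, .inl rfl⟩, Set.subset_insert _ _⟩

lemma HasSpExtension.isCofinal_right (h : HasSpExtension E) (d : α) :
    IsCofinal {r : finiteSpPartialIsos E | ∃ c, (c, d) ∈ r.1} := by
  rintro ⟨r, hr⟩
  obtain ⟨c, hc⟩ := h.exists_insert_right hr d
  exact ⟨⟨_, insert_mem_finiteSpPartialIsos hr hc⟩, ⟨c, .inl rfl⟩, Set.subset_insert _ _⟩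

/-- Back-and-forth, run along an ideal of finite partial isomorphisms that meets the countably
many cofinal families demanding that a given element lies in the domain or in the range. -/
lemma HasSpExtension.exists_orderIso [Countable α] (h : HasSpExtension E)
    (hr : r ∈ finiteSpPartialIsos E) : ∃ g : α ≃o α, ∀ u ∈ r, g u.1 = u.2 := by
  have := Encodable.ofCountable α
  let r₀ : finiteSpPartialIsos E := ⟨r, hr⟩
  let D : α ⊕ α → Order.Cofinal (finiteSpPartialIsos E) :=
    Sum.elim (fun c ↦ ⟨_, h.isCofinal_left c⟩) fun d ↦ ⟨_, h.isCofinal_right d⟩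
  let I := Order.idealOfCofinals r₀ D
  have hle : ∀ u ∈ ⋃ s ∈ I, s.1, ∀ v ∈ ⋃ s ∈ I, s.1, u.1 ≤ v.1 ↔ u.2 ≤ v.2 := by
    intro u hu v hv
    obtain ⟨s, hs, hus⟩ := Set.mem_iUnion₂.1 hu
    obtain ⟨t, ht, hvt⟩ := Set.mem_iUnion₂.1 hv
    obtain ⟨m, -, hsm, htm⟩ := I.directed s hs t ht
    exact m.2.2.2.le_iff (hsm hus) (htm hvt)
  have hleft : ∀ c, ∃ d, (c, d) ∈ ⋃ s ∈ I, s.1 := fun c ↦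
    let ⟨_, ⟨d, hd⟩, hs⟩ := Order.cofinal_meets_idealOfCofinals r₀ D (.inl c)
    ⟨d, Set.mem_biUnion hs hd⟩
  have hright : ∀ d, ∃ c, (c, d) ∈ ⋃ s ∈ I, s.1 := fun d ↦
    let ⟨_, ⟨c, hc⟩, hs⟩ := Order.cofinal_meets_idealOfCofinals r₀ D (.inr d)
    ⟨c, Set.mem_biUnion hs hc⟩
  obtain ⟨g, hg⟩ := exists_orderIso_of_total hle hleft hright
  exact ⟨g, fun u hu ↦ hg u (Set.mem_biUnion (Order.mem_idealOfCofinals r₀ D) hu)⟩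

end PartialIso

section Homogeneity

variable {α : Type*} [LinearOrder α]

attribute [local instance] spStructure

/-- A substructure of `(α, ≤, s, p)` carries the restrictions of the ambient functions. -/
noncomputable abbrev substructureSpStructure (S : spLang.Substructure α) : spLang.Structure S :=
  Language.Substructure.inducedStructure

attribute [local instance] substructureSpStructure

/-- An order automorphism of `α` as an automorphism of the structure `(α, ≤, s, p)`. -/
def spEquivOfOrderIso (g : α ≃o α) : α ≃[spLang] α where
  toEquiv := g.toEquiv
  map_fun' := by
    rintro n (_ | _) x
    exacts [orderIso_map_spSucc g (x 0), orderIso_map_spPred g (x 0)]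
  map_rel' := by
    rintro n (_ | _) x
    exact g.le_iff_le

/-- An automorphism of the structure `(α, ≤, s, p)` as an order automorphism. -/
def orderIsoOfSpEquiv (g : α ≃[spLang] α) : α ≃o α where
  toEquiv := g.toEquiv
  map_rel_iff' {x y} := g.map_rel Language.orderRel.le ![x, y]

variable {S : spLang.Substructure α}

lemma spAct_mem {x : α} (hx : x ∈ S) (w : List Bool) : spAct x w ∈ S := by
  induction w generalizing x with
  | nil => exact hx
  | cons b _ ih =>
    apply ih
    cases b
    · exact S.fun_mem SpFunc.p ![x] fun _ ↦ by simpa using hx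
    · exact S.fun_mem SpFunc.s ![x] fun _ ↦ by simpa using hx

lemma exists_spAct_of_mem_closure {s : Set α} {x : α}
    (hx : x ∈ Language.Substructure.closure spLang s) : ∃ a ∈ s, ∃ w, x = spAct a w := by
  refine Language.Substructure.closure_induction (p := fun x ↦ ∃ a ∈ s, ∃ w, x = spAct a w) hx
    (fun x hx ↦ ⟨x, hx, [], rfl⟩) ?_
  rintro n (_ | _) x hx
  all_goals obtain ⟨a, ha, w, hw⟩ := hx 0
  · exact ⟨a, ha, w ++ [true], by rw [spAct_append, ← hw]; rfl⟩
  · exact ⟨a, ha, w ++ [false], by rw [spAct_append, ← hw]; rfl⟩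

variable (f : S ↪[spLang] α)

lemma embedding_map_spAct {x : α} (hx : x ∈ S) (w : List Bool) :
    f ⟨spAct x w, spAct_mem hx w⟩ = spAct (f ⟨x, hx⟩) w := by
  induction w generalizing x with
  | nil => rfl
  | cons b w ih =>
    refine (ih (spAct_mem hx [b])).trans ?_
    refine congrArg (spAct · w) ?_
    cases b
    · exact f.map_fun SpFunc.p ![⟨x, hx⟩]
    · exact f.map_fun SpFunc.s ![⟨x, hx⟩]

lemma embedding_le_iff (x y : S) : f x ≤ f y ↔ x.1 ≤ y.1 :=
  f.map_rel Language.orderRel.le ![x, y]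

lemma isSpPartialIso_embedding : IsSpPartialIso {u : α × α | ∃ h : u.1 ∈ S, u.2 = f ⟨u.1, h⟩} := by
  rintro u ⟨hu, hfu⟩ v ⟨hv, hfv⟩ w w'
  rw [hfu, hfv, ← embedding_map_spAct f hu, ← embedding_map_spAct f hv, embedding_le_iff]

lemma IsSpPartialIso.exists_embedding {r : Set (α × α)} (hr : IsSpPartialIso r) :
    ∃ f : Language.Substructure.closure spLang (Prod.fst '' r) ↪[spLang] α,
      ∀ u ∈ r, ∃ h, f ⟨u.1, h⟩ = u.2 := by
  let S := Language.Substructure.closure spLang (Prod.fst '' r)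
  have hS : ∀ x : S, ∃ u ∈ r, ∃ w, x.1 = spAct u.1 w := by
    rintro ⟨x, hx⟩
    obtain ⟨_, ⟨u, hu, rfl⟩, w, hw⟩ := exists_spAct_of_mem_closure hx
    exact ⟨u, hu, w, hw⟩
  choose U hU W hW using hS
  let f : S → α := fun x ↦ spAct (U x).2 (W x)
  have hf : ∀ u ∈ r, ∀ w, ∀ x : S, x.1 = spAct u.1 w → f x = spAct u.2 w :=
    fun u hu w x hx ↦ (hr.spAct_eq_iff (hU x) hu _ _).1 ((hW x).symm.trans hx)
  have hle : ∀ x y : S, f x ≤ f y ↔ x.1 ≤ y.1 := fun x y ↦ by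
    rw [hW x, hW y]
    exact (hr _ (hU x) _ (hU y) _ _).symm
  have hstep : ∀ (b : Bool) (x y : S), y.1 = spStep b x.1 → f y = spStep b (f x) :=
    fun b x y hxy ↦ by
      rw [hf _ (hU x) (W x ++ [b]) y, spAct_append]
      · rfl
      · rw [hxy, spAct_append, ← hW]
        rfl
  refine ⟨⟨⟨f, fun x y h ↦ ?_⟩, ?_, ?_⟩, fun u hu ↦ ?_⟩
  · exact Subtype.ext (le_antisymm ((hle _ _).1 h.le) ((hle _ _).1 h.ge))
  · rintro n (_ | _) x
    exacts [hstep true (x 0) _ rfl, hstep false (x 0) _ rfl]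
  · rintro n (_ | _) x
    exact hle _ _
  · exact ⟨Language.Substructure.subset_closure ⟨u, hu, rfl⟩, hf u hu [] _ rfl⟩

variable (E : Finset α)

/-- Every isomorphism between finitely generated substructures of `(α, ≤, s, p)` that is defined
on `E` and fixes it pointwise extends to an automorphism. -/
def EmbeddingsFixingExtend : Prop :=
  ∀ S : spLang.Substructure α, S.FG → ∀ f : S ↪[spLang] α,
    (∀ a ∈ E, ∃ h : a ∈ S, f ⟨a, h⟩ = a) → ∃ g : α ≃[spLang] α, f = g.toEmbedding.comp S.subtype

variable {E}

lemma EmbeddingsFixingExtend.hasSpExtension (h : EmbeddingsFixingExtend E) :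
    HasSpExtension (E : Set α) := by
  rintro r ⟨hfin, hE, hr⟩ c
  obtain ⟨f, hf⟩ := hr.exists_embedding
  obtain ⟨g, hg⟩ := h _ (Language.Substructure.fg_def.2 ⟨_, hfin.image _, rfl⟩) f
    fun a ha ↦ hf (a, a) (hE a ha)
  refine ⟨g c, (isSpPartialIso_graph (orderIsoOfSpEquiv g)).mono ?_⟩
  rintro u (rfl | hu)
  · rfl
  · obtain ⟨hu, hfu⟩ := hf u hu
    rw [Set.mem_ofPred_eq, ← hfu, hg]
    rfl

lemma HasSpExtension.embeddingsFixingExtend [Countable α] (h : HasSpExtension (E : Set α)) :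
    EmbeddingsFixingExtend E := by
  intro S ⟨t, ht⟩ f hf
  have ht_mem : ∀ a ∈ t, a ∈ S := fun a ha ↦ ht ▸ Language.Substructure.subset_closure ha
  let r : Set (α × α) := (fun x : S ↦ (x.1, f x)) '' {x | x.1 ∈ (t ∪ E : Set α)}
  have hr : r ∈ finiteSpPartialIsos (E : Set α) := by
    refine ⟨((t.finite_toSet.union E.finite_toSet).preimage
      Subtype.val_injective.injOn).image _, fun e he ↦ ?_, (isSpPartialIso_embedding f).mono ?_⟩
    · obtain ⟨heS, hfe⟩ := hf e he
      exact ⟨⟨e, heS⟩, .inr he, Prod.ext rfl hfe⟩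
    · rintro _ ⟨x, -, rfl⟩
      exact ⟨x.2, rfl⟩
  obtain ⟨g, hg⟩ := h.exists_orderIso hr
  refine ⟨spEquivOfOrderIso g, Language.Embedding.ext fun ⟨x, hx⟩ ↦ ?_⟩
  obtain ⟨a, ha, w, rfl⟩ := exists_spAct_of_mem_closure (s := (t : Set α)) (ht ▸ hx)
  have hga : g a = f ⟨a, ht_mem a ha⟩ := hg _ ⟨⟨a, ht_mem a ha⟩, .inl ha, rfl⟩
  rw [embedding_map_spAct f (ht_mem a ha), ← hga]
  exact (orderIso_map_spAct g a w).symm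

lemma embeddingsFixingExtend_iff [Countable α] :
    EmbeddingsFixingExtend E ↔ HasSpExtension (E : Set α) :=
  ⟨EmbeddingsFixingExtend.hasSpExtension, HasSpExtension.embeddingsFixingExtend⟩

lemma isSpHomogeneous_iff [Countable α] : IsSpHomogeneous α ↔ HasSpExtension (∅ : Set α) := by
  rw [← Finset.coe_empty, ← embeddingsFixingExtend_iff]
  simp [IsSpHomogeneous, Language.IsUltrahomogeneous, EmbeddingsFixingExtend]

lemma isWeaklySpHomogeneous_iff [Countable α] :
    IsWeaklySpHomogeneous α ↔ ∃ E : Finset α, HasSpExtension (E : Set α) :=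
  exists_congr fun _ ↦ embeddingsFixingExtend_iff

end Homogeneity

/-! ### The arithmetical complexity of homogeneity -/

section IndexedOrder

/-- `L_e` is defined. -/
def IsOrderIndex (e : ℕ) : Prop := ∃ o : LinearOrder ℕ, DefinesLinearOrder e o

/-- The domain `ℕ` of the linear ordering `L_e`. -/
def IndexedOrder (_e : ℕ) : Type := ℕ

open Classical in
/-- `L_e`, with a junk value if `L_e` is not defined. -/
noncomputable instance indexedLinearOrder (e : ℕ) : LinearOrder (IndexedOrder e) :=
  if h : IsOrderIndex e then h.choose else inferInstanceAs (LinearOrder ℕ)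

/-- The identity function. -/
def IndexedOrder.of (e : ℕ) : ℕ ≃ IndexedOrder e := Equiv.refl ℕ

instance (e : ℕ) : Countable (IndexedOrder e) := inferInstanceAs (Countable ℕ)

namespace DefinesLinearOrder

variable {e : ℕ} {o o' : LinearOrder ℕ}

lemma one_mem_phi_iff (h : DefinesLinearOrder e o) (x y : ℕ) :
    1 ∈ phi e (Nat.pair x y) ↔ o.le x y := by
  rw [h x y]
  split_ifs with hxy <;> simp [hxy]

lemma zero_mem_phi_iff (h : DefinesLinearOrder e o) (x y : ℕ) :
    0 ∈ phi e (Nat.pair x y) ↔ ¬ o.le x y := by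
  rw [h x y]
  split_ifs with hxy <;> simp [hxy]

lemma unique (h : DefinesLinearOrder e o) (h' : DefinesLinearOrder e o') : o = o' :=
  LinearOrder.toPartialOrder_injective <| PartialOrder.ext fun x y ↦
    (h.one_mem_phi_iff x y).symm.trans (h'.one_mem_phi_iff x y)

lemma isOrderIndex (h : DefinesLinearOrder e o) : IsOrderIndex e := ⟨o, h⟩

end DefinesLinearOrder

variable {e : ℕ}

lemma IsOrderIndex.definesLinearOrder (he : IsOrderIndex e) :
    DefinesLinearOrder e (indexedLinearOrder e) := by
  have heq : indexedLinearOrder e = he.choose := dif_pos he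
  exact heq ▸ he.choose_spec

lemma exists_definesLinearOrder_and_iff {P : LinearOrder ℕ → Prop} :
    (∃ o, DefinesLinearOrder e o ∧ P o) ↔
      IsOrderIndex e ∧ P (indexedLinearOrder e) :=
  ⟨fun ⟨_, h, hP⟩ ↦ ⟨h.isOrderIndex, h.unique h.isOrderIndex.definesLinearOrder ▸ hP⟩,
    fun ⟨h, hP⟩ ↦ ⟨_, h.definesLinearOrder, hP⟩⟩

lemma mem_spHomogeneousIndices_iff :
    e ∈ spHomogeneousIndices ↔ IsOrderIndex e ∧ IsSpHomogeneous (IndexedOrder e) :=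
  exists_definesLinearOrder_and_iff (P := fun o ↦ @IsSpHomogeneous ℕ o)

lemma mem_weaklySpHomogeneousIndices_iff :
    e ∈ weaklySpHomogeneousIndices ↔ IsOrderIndex e ∧ IsWeaklySpHomogeneous (IndexedOrder e) :=
  exists_definesLinearOrder_and_iff (P := fun o ↦ @IsWeaklySpHomogeneous ℕ o)

/-- A linear order from its ordering relation. -/
noncomputable abbrev linearOrderOfLE {β : Type*} (r : β → β → Prop) (hrefl : ∀ x, r x x)
    (htrans : ∀ x y z, r x y → r y z → r x z) (hanti : ∀ x y, r x y → r y x → x = y)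
    (htotal : ∀ x y, r x y ∨ r y x) : LinearOrder β where
  le := r
  le_refl := hrefl
  le_trans := htrans
  le_antisymm := hanti
  le_total := htotal
  toDecidableLE := Classical.decRel r

lemma isOrderIndex_iff : IsOrderIndex e ↔ ∀ x y z,
    (0 ∈ phi e (Nat.pair x y) ∨ 1 ∈ phi e (Nat.pair x y)) ∧ 1 ∈ phi e (Nat.pair x x) ∧
    (1 ∈ phi e (Nat.pair x y) ∨ 1 ∈ phi e (Nat.pair y x)) ∧
    (1 ∈ phi e (Nat.pair x y) ∧ 1 ∈ phi e (Nat.pair y x) → x = y) ∧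
    (1 ∈ phi e (Nat.pair x y) ∧ 1 ∈ phi e (Nat.pair y z) → 1 ∈ phi e (Nat.pair x z)) := by
  constructor
  · rintro ⟨o, h⟩ x y z
    simp only [h.one_mem_phi_iff, h.zero_mem_phi_iff]
    exact ⟨(em _).symm, o.le_refl _, o.le_total _ _, fun h ↦ o.le_antisymm _ _ h.1 h.2,
      fun h ↦ o.le_trans _ _ _ h.1 h.2⟩
  · intro h
    let o : LinearOrder ℕ := linearOrderOfLE (fun x y ↦ 1 ∈ phi e (Nat.pair x y))
      (fun x ↦ (h x x x).2.1) (fun x y z hxy hyz ↦ (h x y z).2.2.2.2 ⟨hxy, hyz⟩)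
      (fun x y hxy hyx ↦ (h x y x).2.2.2.1 ⟨hxy, hyx⟩) (fun x y ↦ (h x y x).2.2.1)
    refine ⟨o, fun x y ↦ ?_⟩
    split_ifs with hxy
    · exact Part.eq_some_iff.2 hxy
    · exact Part.eq_some_iff.2 ((h x y x).1.resolve_right hxy)

end IndexedOrder

lemma covBy_iff_forall_le {α : Type*} [LinearOrder α] {x y : α} :
    x ⋖ y ↔ ¬ y ≤ x ∧ ∀ z, z ≤ x ∨ y ≤ z := by
  simp only [CovBy, not_le, not_lt, imp_iff_not_or]

lemma exists_list_of_finite {α : Type*} {s : Set α} (hs : s.Finite) :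
    ∃ l : List α, {x | x ∈ l} = s :=
  ⟨hs.toFinset.toList, Set.ext fun _ ↦ Finset.mem_toList.trans hs.mem_toFinset⟩

lemma foldl_eq_iff_exists_getD {β : Type*} (f : ℕ → β → ℕ) (x y : ℕ) (l : List β) (d : β) :
    l.foldl f x = y ↔ ∃ t : List ℕ, t.getD 0 0 = x ∧ t.getD l.length 0 = y ∧
      ∀ i < l.length, f (t.getD i 0) (l.getD i d) = t.getD (i + 1) 0 := by
  have take_succ : ∀ i < l.length,
      (l.take (i + 1)).foldl f x = f ((l.take i).foldl f x) (l.getD i d) := fun i hi ↦ by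
    rw [List.take_add_one, List.getElem?_eq_getElem hi, List.foldl_append,
      List.getD_eq_getElem _ _ hi]
    rfl
  constructor
  · rintro rfl
    have hget : ∀ i ≤ l.length, ((List.range (l.length + 1)).map
        fun i ↦ (l.take i).foldl f x).getD i 0 = (l.take i).foldl f x := fun i hi ↦ by
      simp [List.getD, Nat.lt_succ_of_le hi]
    refine ⟨_, hget 0 (Nat.zero_le _), ?_, fun i hi ↦ ?_⟩
    · rw [hget _ le_rfl, List.take_length]
    · rw [hget _ hi.le, hget _ hi, take_succ i hi]
  · rintro ⟨t, ht0, rfl, ht⟩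
    have hget : ∀ i ≤ l.length, (l.take i).foldl f x = t.getD i 0 := by
      intro i
      induction i with
      | zero => exact fun _ ↦ ht0.symm
      | succ i ih => exact fun hi ↦ by rw [take_succ i hi, ih (Nat.le_of_lt hi), ht i hi]
    rw [← hget _ le_rfl, List.take_length]

section UpperBound

variable {α : Type u} [Primcodable α]

lemma sigmaPredOn_foldl_eq {β : Type v} [Primcodable β] {n : ℕ} {D : α → Prop}
    {f : α → ℕ → β → ℕ} {l : α → List β} {x y : α → ℕ} (d : β)
    (hf : PiPredOn (n + 1) (fun p : (α × List ℕ) × ℕ ↦ D p.1.1) fun p ↦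
      f p.1.1 (p.1.2.getD p.2 0) ((l p.1.1).getD p.2 d) = p.1.2.getD (p.2 + 1) 0)
    (hl : Computable l) (hx : Computable x) (hy : Computable y) :
    SigmaPredOn (n + 2) D fun a ↦ (l a).foldl (f a) (x a) = y a := by
  refine SigmaPredOn.of_iff (.exists (p := fun a (t : List ℕ) ↦ t.getD 0 0 = x a ∧
    t.getD (l a).length 0 = y a ∧ ∀ i, i < (l a).length →
      f a (t.getD i 0) ((l a).getD i d) = t.getD (i + 1) 0) ?_)
    fun a _ ↦ foldl_eq_iff_exists_getD (f a) _ _ _ d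
  refine PiPredOn.toSigma (.and ?_ (.and ?_ (.forall (.imp ?_ hf)))) (Nat.lt_succ_self _)
  · exact .of_computable (computablePred_eq (by fun_prop) (by fun_prop))
  · exact .of_computable (computablePred_eq (by fun_prop) (by fun_prop))
  · exact .of_computable (computablePred_lt (by fun_prop) (by fun_prop))

lemma sigmaPred_mem_phi (b : ℕ) {e x y : α → ℕ} (he : Computable e) (hx : Computable x)
    (hy : Computable y) : SigmaPred 1 fun a ↦ b ∈ phi (e a) (Nat.pair (x a) (y a)) := by
  have hinput : Computable fun p : α × ℕ ↦
      ((p.2, Denumerable.ofNat Nat.Partrec.Code (e p.1)), Nat.pair (x p.1) (y p.1)) :=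
    (Computable.snd.pair ((Computable.ofNat _).comp (he.comp Computable.fst))).pair (by fun_prop)
  refine SigmaPred.of_iff ?_ fun _ ↦ Nat.Partrec.Code.evaln_complete
  exact .exists (.of_computable (computablePred_eq
    (Nat.Partrec.Code.primrec_evaln.to_comp.comp hinput) (Computable.const (some b))))

lemma piPred_isOrderIndex : PiPred 2 IsOrderIndex := by
  refine PiPred.of_iff ?_ fun _ ↦ isOrderIndex_iff
  refine .forall <| .forall <| .forall <| .and (.or ?_ ?_) <| .and ?_ <| .and (.or ?_ ?_) <|
    .and (.imp (.and ?_ ?_) (.of_computable (computablePred_eq (by fun_prop) (by fun_prop))))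
      (.imp (.and ?_ ?_) ?_)
  all_goals
    first
    | exact (sigmaPred_mem_phi _ (by fun_prop) (by fun_prop) (by fun_prop)).toPi one_lt_two
    | exact (sigmaPred_mem_phi _ (by fun_prop) (by fun_prop) (by fun_prop)).mono one_le_two

variable {e x y : α → ℕ} (he : Computable e) (hx : Computable x) (hy : Computable y)

include he hx hy

lemma sigmaPredOn_le : SigmaPredOn 1 (fun a ↦ IsOrderIndex (e a)) fun a ↦
    (IndexedOrder.of (e a) (x a)) ≤ .of (e a) (y a) :=
  ⟨_, sigmaPred_mem_phi 1 he hx hy,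
    fun _ ha ↦ (ha.definesLinearOrder.one_mem_phi_iff _ _).symm⟩

lemma piPredOn_le : PiPredOn 1 (fun a ↦ IsOrderIndex (e a)) fun a ↦
    (IndexedOrder.of (e a) (x a)) ≤ .of (e a) (y a) :=
  ⟨_, sigmaPred_mem_phi 0 he hx hy,
    fun _ ha ↦ (ha.definesLinearOrder.zero_mem_phi_iff _ _).symm⟩

lemma piPredOn_covBy : PiPredOn 1 (fun a ↦ IsOrderIndex (e a)) fun a ↦
    (IndexedOrder.of (e a) (x a)) ⋖ .of (e a) (y a) :=
  PiPredOn.of_iff (.and (.not (sigmaPredOn_le he hy hx)) <|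
    .forall (β := ℕ) <| .or (piPredOn_le (by fun_prop) (by fun_prop) (by fun_prop))
      (piPredOn_le (by fun_prop) (by fun_prop) (by fun_prop))) fun _ _ ↦ covBy_iff_forall_le

lemma piPredOn_spSucc_eq : PiPredOn 2 (fun a ↦ IsOrderIndex (e a)) fun a ↦
    spSucc (IndexedOrder.of (e a) (x a)) = .of (e a) (y a) :=
  PiPredOn.of_iff (.or ((piPredOn_covBy he hx hy).mono one_le_two) <|
    .and (.of_computable (computablePred_eq hx hy)) <| .forall (β := ℕ) <| .not <|
    (piPredOn_covBy (by fun_prop) (by fun_prop) (by fun_prop)).toSigma one_lt_two)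
    fun _ _ ↦ spSucc_eq_iff

lemma piPredOn_spPred_eq : PiPredOn 2 (fun a ↦ IsOrderIndex (e a)) fun a ↦
    spPred (IndexedOrder.of (e a) (x a)) = .of (e a) (y a) :=
  PiPredOn.of_iff (.or ((piPredOn_covBy he hy hx).mono one_le_two) <|
    .and (.of_computable (computablePred_eq hx hy)) <| .forall (β := ℕ) <| .not <|
    (piPredOn_covBy (by fun_prop) (by fun_prop) (by fun_prop)).toSigma one_lt_two)
    fun _ _ ↦ spPred_eq_iff

lemma piPredOn_spStep_eq {b : α → Bool} (hb : Computable b) :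
    PiPredOn 2 (fun a ↦ IsOrderIndex (e a)) fun a ↦
      spStep (b a) (IndexedOrder.of (e a) (x a)) = .of (e a) (y a) :=
  PiPredOn.of_iff (.or
    (.and (.of_computable (computablePred_eq hb (Computable.const true)))
      (piPredOn_spSucc_eq he hx hy))
    (.and (.of_computable (computablePred_eq hb (Computable.const false)))
      (piPredOn_spPred_eq he hx hy))) fun a _ ↦ by
    cases b a <;> simp [spStep]

lemma sigmaPredOn_spAct_eq {w : α → List Bool} (hw : Computable w) :
    SigmaPredOn 3 (fun a ↦ IsOrderIndex (e a)) fun a ↦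
      spAct (IndexedOrder.of (e a) (x a)) (w a) = .of (e a) (y a) :=
  sigmaPredOn_foldl_eq (n := 1) (D := fun a ↦ IsOrderIndex (e a))
    (f := fun a x b ↦ (IndexedOrder.of (e a)).symm (spStep b (.of (e a) x))) true
    (piPredOn_spStep_eq (x := fun p : (α × List ℕ) × ℕ ↦ p.1.2.getD p.2 0)
      (y := fun p ↦ p.1.2.getD (p.2 + 1) 0) (by fun_prop) (by fun_prop) (by fun_prop)
      (by fun_prop)) hw hx hy

variable {w w' : α → List Bool} (hw : Computable w) (hw' : Computable w')

include hw hw'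

lemma sigmaPredOn_spAct_rel {R : ∀ e, IndexedOrder e → IndexedOrder e → Prop}
    (hR : SigmaPredOn 3 (fun p : (α × ℕ) × ℕ ↦ IsOrderIndex (e p.1.1)) fun p ↦
      R (e p.1.1) (.of _ p.1.2) (.of _ p.2)) :
    SigmaPredOn 3 (fun a ↦ IsOrderIndex (e a)) fun a ↦
      R (e a) (spAct (IndexedOrder.of (e a) (x a)) (w a))
        (spAct (IndexedOrder.of (e a) (y a)) (w' a)) := by
  refine SigmaPredOn.of_iff (.exists (p := fun a b ↦ ∃ c : ℕ,
    spAct (IndexedOrder.of (e a) (x a)) (w a) = .of (e a) b ∧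
      spAct (IndexedOrder.of (e a) (y a)) (w' a) = .of (e a) c ∧
      R (e a) (.of (e a) b) (.of (e a) c)) (.exists (.and ?_ (.and ?_ hR)))) fun a _ ↦ ?_
  · exact sigmaPredOn_spAct_eq (by fun_prop) (by fun_prop) (by fun_prop) (by fun_prop)
  · exact sigmaPredOn_spAct_eq (by fun_prop) (by fun_prop) (by fun_prop) (by fun_prop)
  · exact ⟨fun h ↦ ⟨_, _, rfl, rfl, h⟩, fun ⟨_, _, hb, hc, h⟩ ↦ hb ▸ hc ▸ h⟩

lemma sigmaPredOn_spAct_le : SigmaPredOn 3 (fun a ↦ IsOrderIndex (e a)) fun a ↦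
    spAct (IndexedOrder.of (e a) (x a)) (w a) ≤ spAct (IndexedOrder.of (e a) (y a)) (w' a) :=
  sigmaPredOn_spAct_rel he hx hy hw hw' (R := fun _ b c ↦ b ≤ c)
    ((sigmaPredOn_le (by fun_prop) (by fun_prop) (by fun_prop)).mono (by norm_num))

lemma piPredOn_spAct_le : PiPredOn 3 (fun a ↦ IsOrderIndex (e a)) fun a ↦
    spAct (IndexedOrder.of (e a) (x a)) (w a) ≤ spAct (IndexedOrder.of (e a) (y a)) (w' a) :=
  sigmaPredOn_spAct_rel he hx hy hw hw' (R := fun _ b c ↦ ¬ b ≤ c)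
    ((piPredOn_le (by fun_prop) (by fun_prop) (by fun_prop)).mono (by norm_num))

omit hx hy hw hw'

lemma piPredOn_isSpPartialIso {l : α → List (ℕ × ℕ)} (hl : Computable l) :
    PiPredOn 3 (fun a ↦ IsOrderIndex (e a)) fun a ↦
      IsSpPartialIso {u : IndexedOrder (e a) × IndexedOrder (e a) | u ∈ l a} := by
  refine PiPredOn.of_iff (.forall (β := ℕ × ℕ) <| .forall (β := ℕ × ℕ) <|
    .forall (β := List Bool) <| .forall (β := List Bool) <| .imp ?_ <| .imp ?_ <|
    .and (.imp ?_ ?_) (.imp ?_ ?_))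
    fun a _ ↦ ⟨fun h u v w w' hu hv ↦ iff_iff_implies_and_implies.1 (h u hu v hv w w'),
      fun h u hu v hv w w' ↦ iff_iff_implies_and_implies.2 (h u v w w' hu hv)⟩
  · exact .of_computable (computablePred_mem (by fun_prop) (by fun_prop))
  · exact .of_computable (computablePred_mem (by fun_prop) (by fun_prop))
  all_goals
    first
    | exact sigmaPredOn_spAct_le (by fun_prop) (by fun_prop) (by fun_prop) (by fun_prop)
        (by fun_prop)
    | exact piPredOn_spAct_le (by fun_prop) (by fun_prop) (by fun_prop) (by fun_prop)
        (by fun_prop)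

lemma piPredOn_hasSpExtension {E : α → List ℕ} (hE : Computable E) :
    PiPredOn 5 (fun a ↦ IsOrderIndex (e a)) fun a ↦
      HasSpExtension {c : IndexedOrder (e a) | c ∈ E a} := by
  refine PiPredOn.of_iff (p := fun a ↦ ∀ (l : List (ℕ × ℕ)) (c : ℕ),
    (∀ x : ℕ, x ∈ E a → (x, x) ∈ l) →
      IsSpPartialIso {u : IndexedOrder (e a) × IndexedOrder (e a) | u ∈ l} →
        ∃ d : ℕ, IsSpPartialIso {u : IndexedOrder (e a) × IndexedOrder (e a) | u ∈ (c, d) :: l})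
    (.forall <| .forall <| SigmaPredOn.toPi (n := 4) (.imp ?_ <| .imp ?_ <| .exists ?_)
      (Nat.lt_succ_self 4)) fun a _ ↦ ⟨fun h l c hE hl ↦ ?_, fun h r ⟨hfin, hE, hr⟩ c ↦ ?_⟩
  · refine PiPredOn.forall (.imp ?_ ?_) <;>
    exact .of_computable (computablePred_mem (by fun_prop) (by fun_prop))
  · exact (piPredOn_isSpPartialIso (by fun_prop) (by fun_prop)).mono (by norm_num)
  · exact (piPredOn_isSpPartialIso (by fun_prop) (by fun_prop)).toSigma (by norm_num)
  · obtain ⟨d, hd⟩ := h _ ⟨l.finite_toSet, hE, hl⟩ c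
    exact ⟨d, hd.mono fun _ ↦ List.mem_cons.1⟩
  · obtain ⟨l, rfl⟩ := exists_list_of_finite hfin
    obtain ⟨d, hd⟩ := h l c hE hr
    exact ⟨d, hd.mono fun _ ↦ List.mem_cons.2⟩

omit he

lemma isPiZero_spHomogeneousIndices : IsPiZero 5 spHomogeneousIndices := by
  refine isPiZero_iff.2 (((piPredOn_hasSpExtension Computable.id
    (Computable.const [])).and_promise (piPred_isOrderIndex.mono (by norm_num))).of_iff
    fun e ↦ ?_)
  rw [mem_spHomogeneousIndices_iff, isSpHomogeneous_iff]
  have hempty : {c : IndexedOrder e | c ∈ ([] : List ℕ)} = ∅ :=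
    Set.eq_empty_of_forall_notMem fun _ ↦ List.not_mem_nil
  exact and_congr_right fun _ ↦ iff_of_eq (congrArg _ hempty.symm)

lemma isSigmaZero_weaklySpHomogeneousIndices : IsSigmaZero 6 weaklySpHomogeneousIndices := by
  refine isSigmaZero_iff.2 (((SigmaPredOn.exists (p := fun e (l : List ℕ) ↦
    HasSpExtension {c : IndexedOrder e | c ∈ l}) ((piPredOn_hasSpExtension Computable.fst
      Computable.snd).toSigma (Nat.lt_succ_self 5))).and_promise
        (piPred_isOrderIndex.toSigma (by norm_num))).of_iff fun e ↦ ?_)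
  rw [mem_weaklySpHomogeneousIndices_iff, isWeaklySpHomogeneous_iff]
  refine and_congr_right fun _ ↦ Set.exists_finite_iff_finset.symm.trans ⟨?_, ?_⟩
  · rintro ⟨E, hfin, hE⟩
    obtain ⟨l, rfl⟩ := exists_list_of_finite hfin
    exact ⟨l, hE⟩
  · exact fun ⟨l, hl⟩ ↦ ⟨_, l.finite_toSet, hl⟩

end UpperBound

/-! ### Blocks -/

section Blocks

variable {α β : Type*} [LinearOrder α] [LinearOrder β]

/-- `x` has an immediate successor. -/
def HasSucc (x : α) : Prop := ∃ y, x ⋖ y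

/-- `x` has no immediate predecessor: it is the least element of its block, a block being a maximal
set of points with finite distances. -/
def IsRoot (x : α) : Prop := ∀ y, ¬ y ⋖ x

/-- The set of `k` such that the block of `x` has at least `k + 1` elements above `x`. It is an
initial segment of `ℕ` that encodes the number of elements of the block above `x`. -/
def blockShape (x : α) : Set ℕ := {k | HasSucc (spSucc^[k] x)}

/-- `x` is the least element of a block of shape `τ`. -/
def IsRootOfShape (τ : Set ℕ) (x : α) : Prop := IsRoot x ∧ blockShape x = τ

/-- `x < y`, and `x` and `y` lie in different blocks. -/
def BlockLT (x y : α) : Prop := ∀ k, spSucc^[k] x < y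

lemma HasSucc.covBy {x : α} (h : HasSucc x) : x ⋖ spSucc x := by
  obtain ⟨y, hy⟩ := h
  rwa [spSucc_eq_of_covBy hy]

lemma le_spSucc (x : α) : x ≤ spSucc x := by
  by_cases h : HasSucc x
  · exact h.covBy.le
  · exact (spSucc_eq_self h).ge

lemma spSucc_le_of_lt {x y : α} (h : x < y) : spSucc x ≤ y := by
  by_cases hx : HasSucc x
  · exact hx.covBy.ge_of_gt h
  · rw [spSucc_eq_self hx]
    exact h.le

lemma spSucc_mono : Monotone (spSucc (α := α)) := fun x y h ↦ by
  rcases h.eq_or_lt with rfl | h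
  exacts [le_rfl, (spSucc_le_of_lt h).trans (le_spSucc y)]

lemma spPred_le (x : α) : spPred x ≤ x := by
  rcases spPred_eq_iff.1 (rfl : spPred x = spPred x) with h | ⟨h, -⟩
  exacts [h.le, h.ge]

lemma le_spSucc_spPred (x : α) : x ≤ spSucc (spPred x) := by
  rcases spPred_eq_iff.1 (rfl : spPred x = spPred x) with h | ⟨h, -⟩
  · exact (spSucc_eq_of_covBy h).ge
  · exact h.le.trans (le_spSucc _)

lemma lt_spPred_of_spSucc_lt {x y : α} (h : spSucc x < y) : x < spPred y :=
  spSucc_mono.reflect_lt (h.trans_le (le_spSucc_spPred y))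

lemma spStep_le_spSucc (b : Bool) (x : α) : spStep b x ≤ spSucc x := by
  cases b
  exacts [(spPred_le x).trans (le_spSucc x), le_rfl]

lemma spAct_le_spSucc_iterate (x : α) (w : List Bool) : spAct x w ≤ spSucc^[w.length] x := by
  induction w generalizing x with
  | nil => exact le_rfl
  | cons b w ih => exact (ih _).trans (spSucc_mono.iterate _ (spStep_le_spSucc b x))

lemma spAct_replicate_true (x : α) (k : ℕ) : spAct x (List.replicate k true) = spSucc^[k] x := by
  induction k generalizing x with
  | zero => rfl
  | succ _ ih => exact ih (spSucc x)

lemma exists_spAct_spSucc_iterate (x : α) (k : ℕ) : ∃ w, spAct (spSucc^[k] x) w = x := by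
  induction k with
  | zero => exact ⟨[], rfl⟩
  | succ k ih =>
    obtain ⟨w, hw⟩ := ih
    rw [Function.iterate_succ_apply']
    by_cases hs : HasSucc (spSucc^[k] x)
    · refine ⟨false :: w, ?_⟩
      rw [spAct_cons, spStep, cond_false, spPred_eq_of_covBy hs.covBy, hw]
    · exact ⟨w, by rw [spSucc_eq_self hs, hw]⟩

lemma exists_covBy_of_finite_Icc {x y : α} (hxy : x < y) (h : (Set.Icc x y).Finite) :
    ∃ z, x ⋖ z ∧ z ≤ y := by
  have hfin : (Set.Ioc x y).Finite := h.subset Set.Ioc_subset_Icc_self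
  obtain ⟨z, hz, hmin⟩ := hfin.exists_minimal ⟨y, hxy, le_rfl⟩
  refine ⟨z, ⟨hz.1, fun t ht ht' ↦ ?_⟩, hz.2⟩
  exact absurd ht' (not_lt_of_ge (hmin ⟨ht, ht'.le.trans hz.2⟩ ht'.le))

lemma exists_spSucc_iterate_eq_of_finite_Icc {x y : α} (hxy : x ≤ y) (h : (Set.Icc x y).Finite) :
    ∃ k, spSucc^[k] x = y := by
  induction hn : (Set.Icc x y).ncard using Nat.strong_induction_on generalizing x with
  | _ n ih =>
    rcases hxy.eq_or_lt with rfl | hxy'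
    · exact ⟨0, rfl⟩
    · obtain ⟨z, hz, hzy⟩ := exists_covBy_of_finite_Icc hxy' h
      have hsub : Set.Icc z y ⊂ Set.Icc x y :=
        ⟨Set.Icc_subset_Icc_left hz.le, fun h' ↦ (h' ⟨le_rfl, hxy⟩).1.not_gt hz.lt⟩
      obtain ⟨k, hk⟩ := ih _ (hn ▸ Set.ncard_lt_ncard hsub h) hzy (h.subset hsub.1) rfl
      exact ⟨k + 1, by rw [Function.iterate_succ_apply, spSucc_eq_of_covBy hz, hk]⟩

namespace BlockLT

variable {x y z : α}

lemma lt (h : BlockLT x y) : x < y := h 0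

lemma infinite_Icc (h : BlockLT x y) : (Set.Icc x y).Infinite := fun hfin ↦
  let ⟨k, hk⟩ := exists_spSucc_iterate_eq_of_finite_Icc h.lt.le hfin
  (h k).ne hk

lemma trans_le (h : BlockLT x y) (h' : y ≤ z) : BlockLT x z := fun k ↦ (h k).trans_le h'

lemma spAct_right (h : BlockLT x y) (w : List Bool) : BlockLT x (spAct y w) := by
  induction w generalizing y with
  | nil => exact h
  | cons b _ ih =>
    refine ih fun k ↦ ?_
    cases b
    · refine lt_spPred_of_spSucc_lt ?_
      rw [← Function.iterate_succ_apply' spSucc]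
      exact h (k + 1)
    · exact (h k).trans_le (le_spSucc y)

lemma spAct_lt_spAct (h : BlockLT x y) (w w' : List Bool) : spAct x w < spAct y w' :=
  (spAct_le_spSucc_iterate x w).trans_lt (h.spAct_right w' _)

end BlockLT

lemma BlockLT.or_exists_eq {x y : α} (h : x ≤ y) :
    BlockLT x y ∨ ∃ k, spSucc^[k] x = y := by
  refine or_iff_not_imp_right.2 fun hne k ↦ ?_
  induction k with
  | zero => exact h.lt_of_ne fun e ↦ hne ⟨0, e⟩
  | succ k ih =>
    refine lt_of_le_of_ne ?_ fun e ↦ hne ⟨_, e⟩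
    rw [Function.iterate_succ_apply']
    exact spSucc_le_of_lt ih

lemma IsRoot.blockLT {x y : α} (hy : IsRoot y) (h : x < y) : BlockLT x y := by
  intro k
  induction k with
  | zero => exact h
  | succ k ih =>
    rw [Function.iterate_succ_apply']
    refine (spSucc_le_of_lt ih).lt_of_ne fun e ↦ ?_
    by_cases hs : HasSucc (spSucc^[k] x)
    · exact hy _ (e ▸ hs.covBy)
    · exact ih.ne ((spSucc_eq_self hs).symm.trans e)

lemma exists_blockLT_of_finite [Nonempty α] (hbelow : ∀ x : α, ∃ y, BlockLT y x)
    (habove : ∀ x : α, ∃ y, BlockLT x y) {A B : Set α} (hA : A.Finite) (hB : B.Finite)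
    (hAB : ∀ a ∈ A, ∀ b ∈ B, BlockLT a b) :
    ∃ a b, (∀ x ∈ A, x ≤ a) ∧ (∀ x ∈ B, b ≤ x) ∧ BlockLT a b := by
  rcases B.eq_empty_or_nonempty with rfl | hne
  · obtain ⟨a, ha⟩ := hA.bddAbove
    obtain ⟨b, hab⟩ := habove a
    exact ⟨a, b, ha, fun _ hx ↦ hx.elim, hab⟩
  obtain ⟨b, hb, hmin⟩ := Set.exists_min_image B id hB hne
  rcases A.eq_empty_or_nonempty with rfl | hne
  · obtain ⟨a, hab⟩ := hbelow b
    exact ⟨a, b, fun _ hx ↦ hx.elim, hmin, hab⟩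
  obtain ⟨a, ha, hmax⟩ := Set.exists_max_image A id hA hne
  exact ⟨a, b, hmax, hmin, hAB a ha b hb⟩

lemma notMem_blockShape_of_le {x : α} {k l : ℕ} (hk : k ∉ blockShape x) (hkl : k ≤ l) :
    l ∉ blockShape x := by
  induction l, hkl using Nat.le_induction with
  | base => exact hk
  | succ l _ ih =>
    change ¬ HasSucc (spSucc^[l + 1] x)
    rwa [Function.iterate_succ_apply', spSucc_eq_self ih]

lemma blockShape_eq_Iio {x : α} {n : ℕ} (h : ∀ k < n, k ∈ blockShape x)
    (hn : n ∉ blockShape x) : blockShape x = Set.Iio n :=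
  Set.ext fun k ↦ ⟨fun hk ↦ not_le.1 fun hnk ↦ notMem_blockShape_of_le hn hnk hk, h k⟩

lemma blockShape_eq_Iio_or_eq_univ (x : α) :
    (∃ n, blockShape x = Set.Iio n) ∨ blockShape x = Set.univ := by
  classical
  by_cases h : ∃ n, n ∉ blockShape x
  · exact .inl ⟨Nat.find h, blockShape_eq_Iio (fun k hk ↦ not_not.1 (Nat.find_min h hk))
      (Nat.find_spec h)⟩
  · exact .inr (Set.eq_univ_of_forall fun n ↦ not_not.1 fun hn ↦ h ⟨n, hn⟩)

lemma mem_blockShape_iff {x : α} {k : ℕ} :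
    k ∈ blockShape x ↔ spSucc^[k] x < spSucc^[k + 1] x := by
  rw [Function.iterate_succ_apply']
  refine ⟨fun h ↦ HasSucc.covBy h |>.lt, fun h ↦ ?_⟩
  by_contra hk
  exact h.ne (spSucc_eq_self hk).symm

lemma spSucc_iterate_lt_of_lt {x : α} {j k : ℕ} (hjk : j < k)
    (hk : ∀ i < k, i ∈ blockShape x) : spSucc^[j] x < spSucc^[k] x := by
  have hlt := (hk j hjk).covBy.lt
  rw [← Function.iterate_succ_apply' spSucc] at hlt
  exact hlt.trans_le (Function.monotone_iterate_of_id_le le_spSucc hjk x)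

lemma spSucc_iterate_le_iff {x : α} {j k : ℕ} (hj : ∀ i < j, i ∈ blockShape x) :
    spSucc^[j] x ≤ spSucc^[k] x ↔ j ≤ k :=
  ⟨fun h ↦ le_of_not_gt fun h' ↦ h.not_gt (spSucc_iterate_lt_of_lt h' hj),
    fun h ↦ Function.monotone_iterate_of_id_le le_spSucc h x⟩

lemma exists_spAct_eq_spSucc_iterate {x : α} {y : β} (hx : IsRoot x) (hy : IsRoot y)
    (hxy : blockShape x = blockShape y) (w : List Bool) :
    ∃ k, (∀ i < k, i ∈ blockShape x) ∧ spAct x w = spSucc^[k] x ∧ spAct y w = spSucc^[k] y := by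
  induction w using List.reverseRecOn with
  | nil => exact ⟨0, by simp, rfl, rfl⟩
  | append_singleton w b ih =>
    obtain ⟨k, hk, hkx, hky⟩ := ih
    rw [spAct_append, spAct_append, hkx, hky]
    match b, k with
    | false, 0 =>
      exact ⟨0, hk, spPred_eq_iff.2 (.inr ⟨rfl, hx⟩), spPred_eq_iff.2 (.inr ⟨rfl, hy⟩)⟩
    | false, k + 1 =>
      refine ⟨k, fun i hi ↦ hk i (Nat.lt_succ_of_lt hi), ?_, ?_⟩ <;>
        rw [Function.iterate_succ_apply']
      · exact spPred_eq_of_covBy (hk k (Nat.lt_succ_self k)).covBy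
      · exact spPred_eq_of_covBy (hxy ▸ hk k (Nat.lt_succ_self k) : k ∈ blockShape y).covBy
    | true, k =>
      by_cases hs : k ∈ blockShape x
      · refine ⟨k + 1, fun i hi ↦ ?_, ?_, ?_⟩
        · rcases Nat.lt_succ_iff_lt_or_eq.1 hi with hi | rfl
          exacts [hk i hi, hs]
        all_goals rw [Function.iterate_succ_apply']; rfl
      · exact ⟨k, hk, spSucc_eq_self hs, spSucc_eq_self (hxy ▸ hs : k ∉ blockShape y)⟩

lemma isSpPartialIso_singleton {x : α} {y : β} (hx : IsRoot x) (hy : IsRoot y)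
    (hxy : blockShape x = blockShape y) : IsSpPartialIso {(x, y)} := by
  rintro _ rfl _ rfl w w'
  obtain ⟨k, hk, hkx, hky⟩ := exists_spAct_eq_spSucc_iterate hx hy hxy w
  obtain ⟨k', -, hkx', hky'⟩ := exists_spAct_eq_spSucc_iterate hx hy hxy w'
  change spAct x w ≤ spAct x w' ↔ spAct y w ≤ spAct y w'
  rw [hkx, hky, hkx', hky', spSucc_iterate_le_iff hk, spSucc_iterate_le_iff (hxy ▸ hk)]

namespace IsSpPartialIso

variable {r : Set (α × β)} {u v : α × β}

lemma blockLT_iff (hr : IsSpPartialIso r) (hu : u ∈ r) (hv : v ∈ r) :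
    BlockLT u.1 v.1 ↔ BlockLT u.2 v.2 := by
  refine forall_congr' fun k ↦ ?_
  rw [← spAct_replicate_true, ← spAct_replicate_true]
  exact lt_iff_lt_of_le_iff_le (hr v hv u hu [] _)

lemma blockShape_eq (hr : IsSpPartialIso r) (hu : u ∈ r) : blockShape u.1 = blockShape u.2 := by
  ext k
  simp only [mem_blockShape_iff, ← spAct_replicate_true]
  exact lt_iff_lt_of_le_iff_le (hr u hu u hu _ _)

lemma insert_of_separated (hr : IsSpPartialIso r) (hu : IsSpPartialIso {u})
    (hsep : ∀ v ∈ r, (BlockLT v.1 u.1 ∧ BlockLT v.2 u.2) ∨ (BlockLT u.1 v.1 ∧ BlockLT u.2 v.2)) :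
    IsSpPartialIso (insert u r) := by
  have iff_of_blockLT : ∀ a b : α × β, BlockLT a.1 b.1 → BlockLT a.2 b.2 → ∀ w w',
      (spAct a.1 w ≤ spAct b.1 w' ↔ spAct a.2 w ≤ spAct b.2 w') ∧
        (spAct b.1 w' ≤ spAct a.1 w ↔ spAct b.2 w' ≤ spAct a.2 w) := fun a b h₁ h₂ w w' ↦
    ⟨iff_of_true (h₁.spAct_lt_spAct w w').le (h₂.spAct_lt_spAct w w').le,
      iff_of_false (h₁.spAct_lt_spAct w w').not_ge (h₂.spAct_lt_spAct w w').not_ge⟩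
  rintro a (rfl | ha) b (rfl | hb) w w'
  · exact hu _ rfl _ rfl w w'
  · rcases hsep b hb with ⟨h₁, h₂⟩ | ⟨h₁, h₂⟩
    exacts [(iff_of_blockLT b a h₁ h₂ w' w).2, (iff_of_blockLT a b h₁ h₂ w w').1]
  · rcases hsep a ha with ⟨h₁, h₂⟩ | ⟨h₁, h₂⟩
    exacts [(iff_of_blockLT a b h₁ h₂ w w').1, (iff_of_blockLT b a h₁ h₂ w' w).2]
  · exact hr a ha b hb w w'

end IsSpPartialIso

variable {E : Set α}

lemma hasSpExtension_of_roots
    (hroot : ∀ c : α, ∃ x, IsRoot x ∧ ∃ k, spSucc^[k] x = c)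
    (hext : ∀ r ∈ finiteSpPartialIsos E, ∀ x, IsRoot x → ∃ y, IsSpPartialIso (insert (x, y) r)) :
    HasSpExtension E := by
  intro r hr c
  obtain ⟨x, hx, k, rfl⟩ := hroot c
  obtain ⟨y, hy⟩ := hext r hr x hx
  rw [← spAct_replicate_true]
  exact ⟨_, (hy.insert_spAct (Set.mem_insert _ _) _).mono
    (Set.insert_subset_insert (Set.subset_insert _ _))⟩

/-- A root outside the blocks of the domain of a partial isomorphism splits the domain, and its
image can be any root of the same shape that splits the range accordingly. -/
lemma hasSpExtension_of_exists_isRootOfShape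
    (hroot : ∀ c : α, ∃ x, IsRoot x ∧ ∃ k, spSucc^[k] x = c)
    (hbetween : ∀ x : α, IsRoot x → ∀ A B : Set α, A.Finite → B.Finite →
      (∀ a ∈ A, ∀ b ∈ B, BlockLT a b) → (∀ e ∈ E, (e ∈ A ∧ e < x) ∨ (e ∈ B ∧ x < e)) →
      ∃ y, IsRootOfShape (blockShape x) y ∧ (∀ a ∈ A, a < y) ∧ ∀ b ∈ B, BlockLT y b) :
    HasSpExtension E := by
  refine hasSpExtension_of_roots hroot fun r ⟨hfin, hE, hr⟩ x hx ↦ ?_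
  by_cases hdom : ∃ u ∈ r, ∃ w, spAct u.1 w = x
  · obtain ⟨u, hu, w, rfl⟩ := hdom
    exact ⟨_, hr.insert_spAct hu w⟩
  have hsplit : ∀ u ∈ r, u.1 < x ∨ BlockLT x u.1 := fun u hu ↦ by
    refine or_iff_not_imp_left.2 fun h ↦ (BlockLT.or_exists_eq (le_of_not_gt h)).resolve_right ?_
    rintro ⟨k, hk⟩
    obtain ⟨w, hw⟩ := exists_spAct_spSucc_iterate x k
    exact hdom ⟨u, hu, w, hk ▸ hw⟩
  obtain ⟨y, ⟨hy, hxy⟩, hA, hB⟩ := hbetween x hx (Prod.snd '' {u ∈ r | u.1 < x})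
    (Prod.snd '' {u ∈ r | BlockLT x u.1}) ((hfin.sep _).image _) ((hfin.sep _).image _)
    (by
      rintro _ ⟨u, ⟨hu, hux⟩, rfl⟩ _ ⟨v, ⟨hv, hxv⟩, rfl⟩
      exact (hr.blockLT_iff hu hv).1 ((hx.blockLT hux).trans_le hxv.lt.le))
    fun e he ↦ (hsplit _ (hE e he)).imp (fun h ↦ ⟨⟨_, ⟨hE e he, h⟩, rfl⟩, h⟩)
      fun h ↦ ⟨⟨_, ⟨hE e he, h⟩, rfl⟩, h.lt⟩
  exact ⟨y, hr.insert_of_separated (isSpPartialIso_singleton hx hy hxy.symm) fun u hu ↦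
    (hsplit u hu).imp (fun h ↦ ⟨hx.blockLT h, hy.blockLT (hA _ ⟨u, ⟨hu, h⟩, rfl⟩)⟩)
      fun h ↦ ⟨h, hB _ ⟨u, ⟨hu, h⟩, rfl⟩⟩⟩

section OrdConnected

variable (f : α ↪o β) (hf : (Set.range f).OrdConnected) {x : α}

include hf

lemma exists_eq_of_apply_covBy [NoMaxOrder α] {y : β} (h : f x ⋖ y) : ∃ z, f z = y ∧ x ⋖ z := by
  obtain ⟨t, ht⟩ := exists_gt x
  obtain ⟨z, rfl⟩ : y ∈ Set.range f := hf.out ⟨x, rfl⟩ ⟨t, rfl⟩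
    ⟨h.le, h.ge_of_gt (f.lt_iff_lt.2 ht)⟩
  exact ⟨z, rfl, (hf.apply_covBy_apply_iff f).1 h⟩

lemma isRoot_orderEmbedding [NoMinOrder α] (hx : IsRoot x) : IsRoot (f x) := by
  intro y hy
  obtain ⟨t, ht⟩ := exists_lt x
  obtain ⟨z, rfl⟩ : y ∈ Set.range f := hf.out ⟨t, rfl⟩ ⟨x, rfl⟩
    ⟨hy.le_of_lt (f.lt_iff_lt.2 ht), hy.le⟩
  exact hx z ((hf.apply_covBy_apply_iff f).1 hy)

variable [NoMaxOrder α]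

lemma hasSucc_orderEmbedding_iff : HasSucc (f x) ↔ HasSucc x := by
  constructor
  · rintro ⟨y, hy⟩
    obtain ⟨z, -, hz⟩ := exists_eq_of_apply_covBy f hf hy
    exact ⟨z, hz⟩
  · rintro ⟨y, hy⟩
    exact ⟨f y, (hf.apply_covBy_apply_iff f).2 hy⟩

lemma orderEmbedding_spSucc (x : α) : f (spSucc x) = spSucc (f x) := by
  by_cases h : HasSucc x
  · exact (spSucc_eq_of_covBy ((hf.apply_covBy_apply_iff f).2 h.covBy)).symm
  · rw [spSucc_eq_self h, spSucc_eq_self fun h' ↦ h ((hasSucc_orderEmbedding_iff f hf).1 h')]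

lemma orderEmbedding_spSucc_iterate (k : ℕ) (x : α) : f (spSucc^[k] x) = spSucc^[k] (f x) :=
  (Function.Semiconj.iterate_right (orderEmbedding_spSucc f hf) k).eq x

lemma blockShape_orderEmbedding : blockShape (f x) = blockShape x := by
  ext k
  change HasSucc _ ↔ HasSucc _
  rw [← orderEmbedding_spSucc_iterate f hf, hasSucc_orderEmbedding_iff f hf]

lemma isRootOfShape_orderEmbedding [NoMinOrder α] {τ : Set ℕ} (h : IsRootOfShape τ x) :
    IsRootOfShape τ (f x) :=
  ⟨isRoot_orderEmbedding f hf h.1, (blockShape_orderEmbedding f hf).trans h.2⟩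

lemma blockLT_orderEmbedding_iff {y : α} : BlockLT (f x) (f y) ↔ BlockLT x y :=
  forall_congr' fun k ↦ by rw [← orderEmbedding_spSucc_iterate f hf, f.lt_iff_lt]

end OrdConnected

end Blocks

/-! ### Orders of words -/

/-- Data for an order of words over the letters `(q, j)`, where `q` lies in a dense order without
endpoints and `j` is called the place. The colour `Sum.inl k` allows the places `j ≤ k` and ends a
word, so that it produces blocks with `k + 1` elements; the colour `Sum.inr m` allows all places,
and the words that may follow at place `j` are those in `tails i m j`, where `i` is an index passed
on from the first letter of the word. -/
structure WordData (Q : Type*) [LinearOrder Q] where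
  /-- The colour of an element of the dense order. -/
  color : Q → ℕ ⊕ ℕ
  exists_between : ∀ c q q', q < q' → ∃ p, q < p ∧ p < q' ∧ color p = c
  exists_below : ∀ c q, ∃ p < q, color p = c
  exists_above : ∀ c q, ∃ p > q, color p = c
  /-- The words that may follow a letter of colour `Sum.inr m` at place `j` for the index `i`. -/
  tails : ℕ → ℕ → ℕ → Set (List (Q ×ₗ ℕ))
  nil_mem_tails : ∀ i m j, [] ∈ tails i m j
  tails_mono : ∀ i m, Monotone (tails i m)
  finite_tails : ∀ i m j, tails i m j ≠ Set.univ → (tails i m j).Finite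

namespace WordData

variable {Q : Type*} [LinearOrder Q] (D : WordData Q) (ι : Q → ℕ)

/-- The words that fit after the letter `(q, j)`, where `ι` gives the index. -/
def fits (q : Q) (j : ℕ) : Set (List (Q ×ₗ ℕ)) :=
  (D.color q).elim (fun k ↦ {u | j ≤ k ∧ u = []}) fun m ↦ D.tails (ι q) m j

/-- All words fit after the letter `(q, j)`. -/
def Full (q : Q) (j : ℕ) : Prop := D.fits ι q j = Set.univ

/-- Some colour produces blocks of type `ω` at index `i`. -/
def HasOmega (i : ℕ) : Prop := ∃ m, ∀ j, D.tails i m j ≠ Set.univ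

/-- Admitted words. The index of the first letter is passed on to all letters after it. -/
def Valid : (Q → ℕ) → List (Q ×ₗ ℕ) → Prop
  | _, [] => True
  | ι, a :: u => Valid (fun _ ↦ ι (ofLex a).1) u ∧ u ∈ D.fits ι (ofLex a).1 (ofLex a).2

/-- The order of nonempty admitted words. -/
abbrev Words : Type _ := {u : List (Q ×ₗ ℕ) // u ≠ [] ∧ D.Valid ι u}

/-- The words that can be appended to the letter `(q, j)`. -/
abbrev Tail (q : Q) (j : ℕ) : Type _ :=
  {u : List (Q ×ₗ ℕ) // D.Valid (fun _ ↦ ι q) u ∧ u ∈ D.fits ι q j}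

variable {D ι} {q q' : Q} {j j' : ℕ}

lemma fits_of_color_inl {k : ℕ} (h : D.color q = .inl k) :
    D.fits ι q j = {u | j ≤ k ∧ u = []} := by
  rw [fits, h, Sum.elim_inl]

lemma fits_of_color_inr {m : ℕ} (h : D.color q = .inr m) : D.fits ι q j = D.tails (ι q) m j := by
  rw [fits, h, Sum.elim_inr]

lemma le_and_eq_nil_of_color_inl {k : ℕ} {u : List (Q ×ₗ ℕ)} (h : D.color q = .inl k)
    (hu : u ∈ D.fits ι q j) : j ≤ k ∧ u = [] := by
  rwa [fits_of_color_inl h] at hu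

lemma not_full_of_color_inl {k : ℕ} (h : D.color q = .inl k) : ¬ D.Full ι q j := fun hf ↦ by
  have hmem : [toLex (q, 0)] ∈ D.fits ι q j := hf ▸ Set.mem_univ _
  rw [fits_of_color_inl h] at hmem
  exact List.cons_ne_nil _ _ hmem.2

lemma Full.exists_color (h : D.Full ι q j) : ∃ m, D.color q = .inr m := by
  rcases hc : D.color q with k | m
  exacts [absurd h (not_full_of_color_inl hc), ⟨m, rfl⟩]

lemma Full.mono (hj : j ≤ j') (h : D.Full ι q j) : D.Full ι q j' := by
  obtain ⟨m, hm⟩ := h.exists_color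
  rw [Full, fits_of_color_inr hm] at h ⊢
  exact Set.univ_subset_iff.1 (h ▸ D.tails_mono _ _ hj)

lemma nil_mem_fits_of_color_inr {m : ℕ} (h : D.color q = .inr m) : [] ∈ D.fits ι q j :=
  fits_of_color_inr (D := D) h ▸ D.nil_mem_tails _ _ _

lemma Full.nil_mem_fits (h : D.Full ι q j) (j' : ℕ) : [] ∈ D.fits ι q j' :=
  nil_mem_fits_of_color_inr h.exists_color.choose_spec

lemma nil_mem_fits_zero : [] ∈ D.fits ι q 0 := by
  rcases hc : D.color q with k | m
  · rw [fits_of_color_inl hc]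
    exact ⟨k.zero_le, rfl⟩
  · exact nil_mem_fits_of_color_inr hc

lemma finite_fits (h : ¬ D.Full ι q j) : (D.fits ι q j).Finite := by
  rcases hc : D.color q with k | m
  · rw [fits_of_color_inl hc]
    exact (Set.finite_singleton []).subset fun _ hu ↦ hu.2
  · rw [Full, fits_of_color_inr hc] at h
    rw [fits_of_color_inr hc]
    exact D.finite_tails _ _ _ h

/-- The word `(q, j) :: u`. -/
def cons (q : Q) (j : ℕ) (u : D.Tail ι q j) : D.Words ι :=
  ⟨toLex (q, j) :: u.1, List.cons_ne_nil _ _, u.2⟩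

/-- The one-letter word `(q, j)`. -/
def single (q : Q) (j : ℕ) (h : [] ∈ D.fits ι q j) : D.Words ι := cons q j ⟨[], trivial, h⟩

/-- The one-letter word `(q, 0)`. -/
def base (D : WordData Q) (ι : Q → ℕ) (q : Q) : D.Words ι := single q 0 nil_mem_fits_zero

/-- The first component of the first letter. -/
def top (x : D.Words ι) : Q := (ofLex (x.1.head x.2.1)).1

lemma exists_eq_cons (x : D.Words ι) : ∃ q j u, x = cons q j u := by
  obtain ⟨_ | ⟨a, u⟩, h, h'⟩ := x
  · exact absurd rfl h
  · exact ⟨(ofLex a).1, (ofLex a).2, ⟨u, h'⟩, rfl⟩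

lemma ne_nil_of_lt {u v : List (Q ×ₗ ℕ)} (h : u < v) : v ≠ [] :=
  fun hv ↦ List.not_lt_nil _ (hv ▸ h)

lemma cons_lt_cons_iff {u : D.Tail ι q j} {v : D.Tail ι q' j'} :
    cons q j u < cons q' j' v ↔ q < q' ∨ q = q' ∧ (j < j' ∨ j = j' ∧ u.1 < v.1) := by
  change toLex (q, j) :: u.1 < toLex (q', j') :: v.1 ↔ _
  rw [List.cons_lt_cons_iff, Prod.Lex.toLex_lt_toLex, toLex.injective.eq_iff, Prod.mk.injEq]
  tauto

lemma cons_lt_cons_same_iff {u : D.Tail ι q j} {v : D.Tail ι q j'} :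
    cons q j u < cons q j' v ↔ j < j' ∨ j = j' ∧ u.1 < v.1 := by
  simp only [cons_lt_cons_iff, lt_irrefl, true_and, false_or]

lemma lt_of_top_lt {x y : D.Words ι} (h : top x < top y) : x < y := by
  obtain ⟨q, j, u, rfl⟩ := exists_eq_cons x
  obtain ⟨q', j', v, rfl⟩ := exists_eq_cons y
  exact cons_lt_cons_iff.2 (.inl h)

lemma monotone_top : Monotone (top : D.Words ι → Q) := fun _ _ h ↦
  le_of_not_gt fun h' ↦ (lt_of_top_lt h').not_ge h

lemma base_top_le (x : D.Words ι) : base D ι (top x) ≤ x := by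
  obtain ⟨q, j, u, rfl⟩ := exists_eq_cons x
  change base D ι q ≤ _
  rw [← not_lt, base, single, cons_lt_cons_same_iff]
  rintro (h | ⟨-, h⟩)
  exacts [Nat.not_lt_zero _ h, List.not_lt_nil _ h]

instance : NoMinOrder (D.Words ι) where
  exists_lt x :=
    let ⟨p, hp, _⟩ := D.exists_below (.inl 0) (top x)
    ⟨base D ι p, lt_of_top_lt hp⟩

instance : NoMaxOrder (D.Words ι) where
  exists_gt x :=
    let ⟨p, hp, _⟩ := D.exists_above (.inl 0) (top x)
    ⟨base D ι p, lt_of_top_lt hp⟩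

lemma top_eq_of_covBy {x y : D.Words ι} (h : x ⋖ y) : top x = top y := by
  refine (monotone_top h.le).eq_or_lt.resolve_right fun h' ↦ ?_
  obtain ⟨p, hp, hp', -⟩ := D.exists_between (.inl 0) _ _ h'
  exact h.2 (c := base D ι p) (lt_of_top_lt hp) (lt_of_top_lt hp')

lemma top_spSucc_iterate (k : ℕ) (x : D.Words ι) : top (spSucc^[k] x) = top x := by
  induction k with
  | zero => rfl
  | succ k ih =>
    rw [Function.iterate_succ_apply', ← ih]
    by_cases h : HasSucc (spSucc^[k] x)
    · exact (top_eq_of_covBy h.covBy).symm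
    · rw [spSucc_eq_self h]

lemma blockLT_of_top_lt {x y : D.Words ι} (h : top x < top y) : BlockLT x y := fun k ↦
  lt_of_top_lt ((top_spSucc_iterate k x).trans_lt h)

lemma exists_blockLT_left (x : D.Words ι) : ∃ y, BlockLT y x :=
  let ⟨p, hp, _⟩ := D.exists_below (.inl 0) (top x)
  ⟨base D ι p, blockLT_of_top_lt hp⟩

lemma exists_blockLT_right (x : D.Words ι) : ∃ y, BlockLT x y :=
  let ⟨p, hp, _⟩ := D.exists_above (.inl 0) (top x)
  ⟨base D ι p, blockLT_of_top_lt hp⟩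

lemma isRoot_base (q : Q) : IsRoot (base D ι q) := fun y hy ↦ by
  have hle := base_top_le y
  rw [top_eq_of_covBy hy] at hle
  exact hle.not_gt hy.lt

/-- The embedding that puts a letter `(q, j)` at which all words fit in front of each word. -/
def lift (q : Q) (j : ℕ) (h : D.Full ι q j) : D.Words (fun _ ↦ ι q) ↪o D.Words ι :=
  OrderEmbedding.ofStrictMono (fun u ↦ cons q j ⟨u.1, u.2.2, h ▸ Set.mem_univ _⟩) fun _ _ huv ↦
    cons_lt_cons_same_iff.2 (.inr ⟨rfl, huv⟩)

lemma exists_eq_lift (h : D.Full ι q j) (u : D.Tail ι q j) (hu : u.1 ≠ []) :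
    ∃ y, cons q j u = lift q j h y :=
  ⟨⟨u.1, hu, u.2.1⟩, rfl⟩

lemma single_lt_lift (h : D.Full ι q j) (h' : [] ∈ D.fits ι q j) (y : D.Words fun _ ↦ ι q) :
    single q j h' < lift q j h y :=
  cons_lt_cons_same_iff.2
    (.inr ⟨rfl, lt_of_le_of_ne (le_of_not_gt (List.not_lt_nil _)) y.2.1.symm⟩)

lemma ordConnected_range_lift (h : D.Full ι q j) : (Set.range (lift q j h)).OrdConnected := by
  refine ⟨?_⟩
  rintro _ ⟨u, rfl⟩ _ ⟨v, rfl⟩ x ⟨hux, hxv⟩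
  obtain ⟨q', j', w, rfl⟩ := exists_eq_cons x
  obtain rfl : q' = q := le_antisymm (monotone_top hxv) (monotone_top hux)
  have hj : j = j' := le_antisymm
    (not_lt.1 fun hlt ↦ hux.not_gt (cons_lt_cons_same_iff.2 (.inl hlt)))
    (not_lt.1 fun hlt ↦ hxv.not_gt (cons_lt_cons_same_iff.2 (.inl hlt)))
  subst hj
  have hw : w.1 ≠ [] := fun hw ↦ by
    obtain rfl : w = ⟨[], trivial, h ▸ Set.mem_univ _⟩ := Subtype.ext hw
    exact hux.not_gt (single_lt_lift h (h.nil_mem_fits j) u)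
  exact ⟨⟨w.1, hw, w.2.1⟩, rfl⟩

/-- Induction over words: if a letter is followed by a word, and all words fit after that letter,
then pass to the order of these words. -/
lemma induction_lift {P : ∀ ι : Q → ℕ, D.Words ι → Prop}
    (lift : ∀ ι q j (h : D.Full ι q j) y, P (fun _ ↦ ι q) y → P ι (lift q j h y))
    (cons : ∀ ι q j (u : D.Tail ι q j), ¬ D.Full ι q j ∨ u.1 = [] → P ι (cons q j u))
    (x : D.Words ι) : P ι x := by
  obtain ⟨l, hl, hl'⟩ := x
  induction l generalizing ι with
  | nil => exact absurd rfl hl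
  | cons a u ih =>
    by_cases h : D.Full ι (ofLex a).1 (ofLex a).2 ∧ u ≠ []
    · exact lift ι _ _ h.1 ⟨u, h.2, hl'.1⟩ (ih h.2 hl'.1)
    · exact cons ι _ _ ⟨u, hl'⟩ ((not_and_or.1 h).imp_right not_not.1)

/-! ### Blocks of words -/

lemma exists_lt_lift (h : D.Full ι q j) (u : D.Tail ι q j) : ∃ y, cons q j u < lift q j h y := by
  by_cases hu : u.1 = []
  · obtain rfl : u = ⟨[], trivial, h ▸ Set.mem_univ _⟩ := Subtype.ext hu
    exact ⟨base D _ q, single_lt_lift h (h.nil_mem_fits j) _⟩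
  · obtain ⟨x, hx⟩ := exists_eq_lift h u hu
    obtain ⟨y, hxy⟩ := exists_gt x
    exact ⟨y, hx ▸ (lift q j h).lt_iff_lt.2 hxy⟩

lemma not_hasSucc_single (h : D.Full ι q j) (h' : [] ∈ D.fits ι q j) :
    ¬ HasSucc (single q j h') := by
  rintro ⟨y, hy⟩
  obtain ⟨q', j', v, rfl⟩ := exists_eq_cons y
  obtain rfl : q = q' := top_eq_of_covBy hy
  rcases cons_lt_cons_same_iff.1 hy.lt with hlt | ⟨rfl, hv⟩
  · exact hy.2 (single_lt_lift h h' (base D _ q)) (cons_lt_cons_same_iff.2 (.inl hlt))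
  · obtain ⟨x, hx⟩ := exists_eq_lift h v (ne_nil_of_lt hv)
    obtain ⟨y, hyx⟩ := exists_lt x
    exact hy.2 (single_lt_lift h h' y) (hx ▸ (lift q j h).lt_iff_lt.2 hyx)

lemma isRoot_single_succ (h : D.Full ι q j) (h' : [] ∈ D.fits ι q (j + 1)) :
    IsRoot (single q (j + 1) h') := fun y hy ↦ by
  obtain ⟨q', j', v, rfl⟩ := exists_eq_cons y
  obtain rfl : q' = q := top_eq_of_covBy hy
  have lift_lt : ∀ y, lift q' j h y < single q' (j + 1) h' := fun y ↦
    cons_lt_cons_same_iff.2 (.inl (Nat.lt_succ_self j))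
  rcases cons_lt_cons_same_iff.1 hy.lt with hlt | ⟨-, hv⟩
  · rcases Nat.lt_succ_iff_lt_or_eq.1 hlt with hlt | rfl
    · exact hy.2 (cons_lt_cons_same_iff.2 (.inl hlt)) (lift_lt (base D _ q'))
    · obtain ⟨y, hvy⟩ := exists_lt_lift h v
      exact hy.2 hvy (lift_lt y)
  · exact List.not_lt_nil _ hv

lemma finite_Icc_cons {u : D.Tail ι q j} {v : D.Tail ι q j'}
    (hlt : ∀ i, j ≤ i → i < j' → ¬ D.Full ι q i) (hv : ¬ D.Full ι q j' ∨ v.1 = []) :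
    (Set.Icc (cons q j u) (cons q j' v)).Finite := by
  let S : ℕ → Set (List (Q ×ₗ ℕ)) := fun i ↦ {w | w ∈ D.fits ι q i ∧ (i = j' → w ≤ v.1)}
  have hS : ∀ i ∈ Set.Icc j j', (List.cons (toLex (q, i)) '' S i).Finite := fun i hi ↦ by
    refine Set.Finite.image _ ?_
    by_cases hf : D.Full ι q i
    · obtain rfl := (hi.2.eq_or_lt).resolve_right fun h ↦ hlt i hi.1 h hf
      have hnil := hv.resolve_left (not_not_intro hf)
      exact (Set.finite_singleton []).subset fun w hw ↦
        le_antisymm (hnil ▸ hw.2 rfl) (le_of_not_gt (List.not_lt_nil w))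
    · exact (finite_fits hf).subset fun w hw ↦ hw.1
  refine Set.Finite.of_finite_image (f := Subtype.val)
    (((Set.finite_Icc j j').biUnion hS).subset ?_) Subtype.val_injective.injOn
  rintro _ ⟨x, ⟨hx, hx'⟩, rfl⟩
  obtain ⟨q', i, w, rfl⟩ := exists_eq_cons x
  obtain rfl : q' = q := le_antisymm (monotone_top hx') (monotone_top hx)
  rw [← not_lt, cons_lt_cons_same_iff, not_or, not_and, not_lt] at hx hx'
  exact Set.mem_biUnion ⟨hx.1, hx'.1⟩ ⟨w.1, ⟨w.2.2, fun hi ↦ not_lt.1 (hx'.2 hi.symm)⟩, rfl⟩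

lemma exists_root (x : D.Words ι) : ∃ y, IsRoot y ∧ ∃ k, spSucc^[k] y = x := by
  induction x using induction_lift with
  | lift ι q j h x ih =>
    obtain ⟨y, hy, k, rfl⟩ := ih
    have hoc := ordConnected_range_lift h
    exact ⟨_, isRoot_orderEmbedding _ hoc hy, k, (orderEmbedding_spSucc_iterate _ hoc k y).symm⟩
  | cons ι q j u hu =>
    by_cases hfull : ∃ i < j, D.Full ι q i
    · obtain ⟨i, hij, hi⟩ := hfull
      obtain ⟨j, rfl⟩ := Nat.exists_eq_add_of_lt hij
      obtain ⟨u, hu'⟩ := u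
      obtain rfl := hu.resolve_left (not_not_intro (hi.mono hij.le))
      exact ⟨_, isRoot_single_succ (hi.mono (Nat.le_add_right i j)) hu'.2, 0, rfl⟩
    · have hempty : ∀ i, 0 ≤ i → i < j → ¬ D.Full ι q i := fun i _ hij hi ↦ hfull ⟨i, hij, hi⟩
      exact ⟨base D ι q, isRoot_base q, exists_spSucc_iterate_eq_of_finite_Icc
        (base_top_le (cons q j u)) (finite_Icc_cons hempty hu)⟩

lemma single_covBy_of_color_inl {k n : ℕ} (hq : D.color q = .inl n)
    (h : [] ∈ D.fits ι q k) (h' : [] ∈ D.fits ι q (k + 1)) :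
    single q k h ⋖ single q (k + 1) h' := by
  refine ⟨cons_lt_cons_same_iff.2 (.inl (Nat.lt_succ_self k)), fun x hx hx' ↦ ?_⟩
  obtain ⟨q', j, u, rfl⟩ := exists_eq_cons x
  obtain rfl : q' = q := le_antisymm (monotone_top hx'.le) (monotone_top hx.le)
  have hu : u.1 = [] := (le_and_eq_nil_of_color_inl hq u.2.2).2
  simp only [single, cons_lt_cons_same_iff, hu, lt_irrefl, and_false, or_false] at hx hx'
  exact (Nat.lt_succ_iff.1 hx').not_gt hx

lemma not_hasSucc_single_of_color_inl {k : ℕ} (hq : D.color q = .inl k)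
    (h : [] ∈ D.fits ι q k) : ¬ HasSucc (single q k h) := by
  rintro ⟨y, hy⟩
  obtain ⟨q', j, v, rfl⟩ := exists_eq_cons y
  obtain rfl : q = q' := top_eq_of_covBy hy
  obtain ⟨hj, hv⟩ : j ≤ k ∧ v.1 = [] := le_and_eq_nil_of_color_inl hq v.2.2
  rcases cons_lt_cons_same_iff.1 hy.lt with hlt | ⟨-, hlt⟩
  exacts [hj.not_gt hlt, List.not_lt_nil _ (hv ▸ hlt)]

lemma blockShape_base_of_color_inl {n : ℕ} (hq : D.color q = .inl n) :
    blockShape (base D ι q) = Set.Iio n := by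
  have hfits : ∀ k ≤ n, [] ∈ D.fits ι q k := fun k hk ↦ by
    rw [fits_of_color_inl hq]
    exact ⟨hk, rfl⟩
  have hcovBy : ∀ k (hk : k < n), single q k (hfits k hk.le) ⋖ single q (k + 1) (hfits _ hk) :=
    fun k _ ↦ single_covBy_of_color_inl hq _ _
  have hiterate : ∀ k (hk : k ≤ n), spSucc^[k] (base D ι q) = single q k (hfits k hk) := by
    intro k hk
    induction k with
    | zero => rfl
    | succ k ih =>
      rw [Function.iterate_succ_apply', ih (Nat.le_of_succ_le hk), spSucc_eq_of_covBy (hcovBy k hk)]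
  refine blockShape_eq_Iio (fun k hk ↦ ?_) fun hn ↦ ?_
  · exact ⟨_, (hiterate k hk.le).symm ▸ hcovBy k hk⟩
  · change HasSucc (spSucc^[n] (base D ι q)) at hn
    rw [hiterate n le_rfl] at hn
    exact not_hasSucc_single_of_color_inl hq _ hn

lemma blockShape_base_of_color_inr {m : ℕ} (hq : D.color q = .inr m)
    (hm : ∀ j, D.tails (ι q) m j ≠ Set.univ) : blockShape (base D ι q) = Set.univ := by
  have hfull : ∀ j, ¬ D.Full ι q j := fun j ↦ by
    rw [Full, fits_of_color_inr hq]
    exact hm j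
  have hasSucc_of_top : ∀ x : D.Words ι, top x = q → HasSucc x := by
    intro x hx
    obtain ⟨q', j, u, rfl⟩ := exists_eq_cons x
    obtain rfl : q' = q := hx
    obtain ⟨z, hz, -⟩ := exists_covBy_of_finite_Icc
      (cons_lt_cons_same_iff.2 (.inl (Nat.lt_succ_self j)))
      (finite_Icc_cons (u := u) (v := ⟨[], trivial, nil_mem_fits_of_color_inr hq⟩)
        (fun i _ _ ↦ hfull i) (.inr rfl))
    exact ⟨z, hz⟩
  exact Set.eq_univ_of_forall fun k ↦ hasSucc_of_top _ (top_spSucc_iterate k _)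

lemma exists_notMem_blockShape_of_le_single {i : ℕ} {u : D.Tail ι q j} {h : [] ∈ D.fits ι q i}
    (hu : cons q j u ≤ single q i h) (hfull : ∀ l, j ≤ l → l < i → ¬ D.Full ι q l)
    (hi : ¬ HasSucc (single q i h)) : ∃ k, k ∉ blockShape (cons q j u) := by
  obtain ⟨k, hk⟩ := exists_spSucc_iterate_eq_of_finite_Icc hu (finite_Icc_cons hfull (.inr rfl))
  refine ⟨k, fun hk' ↦ hi ?_⟩
  rwa [blockShape, Set.mem_ofPred_eq, hk] at hk'

lemma exists_notMem_blockShape (x : D.Words ι) (hx : ¬ D.HasOmega (ι (top x))) :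
    ∃ k, k ∉ blockShape x := by
  induction x using induction_lift with
  | lift ι q j h x ih =>
    rw [blockShape_orderEmbedding _ (ordConnected_range_lift h)]
    exact ih hx
  | cons ι q j u hu =>
    rcases hc : D.color q with n | m
    · obtain ⟨hj, hu⟩ : j ≤ n ∧ u.1 = [] := le_and_eq_nil_of_color_inl hc u.2.2
      have hn : [] ∈ D.fits ι q n := by
        rw [fits_of_color_inl hc]
        exact ⟨le_rfl, rfl⟩
      refine exists_notMem_blockShape_of_le_single (h := hn) ?_
        (fun l _ _ ↦ not_full_of_color_inl hc) (not_hasSucc_single_of_color_inl hc hn)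
      rw [← not_lt, single, cons_lt_cons_same_iff, hu, not_or, not_and]
      exact ⟨hj.not_gt, fun _ ↦ lt_irrefl _⟩
    · have hfull : ∃ i, D.Full ι q i := by
        by_contra! h
        exact hx ⟨m, fun i ↦ fits_of_color_inr (D := D) hc ▸ h i⟩
      by_cases hj : D.Full ι q j
      · obtain ⟨u, hu'⟩ := u
        obtain rfl := hu.resolve_left (not_not_intro hj)
        exact ⟨0, not_hasSucc_single hj hu'.2⟩
      · classical
        have hlt : j < Nat.find hfull := not_le.1 fun h ↦ hj ((Nat.find_spec hfull).mono h)
        exact exists_notMem_blockShape_of_le_single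
          (cons_lt_cons_same_iff.2 (.inl hlt)).le (fun l _ ↦ Nat.find_min hfull)
          (not_hasSucc_single (Nat.find_spec hfull) (nil_mem_fits_of_color_inr hc))

end WordData

/-! ### Orders of words as shuffles -/

namespace WordData

variable {Q : Type*} [LinearOrder Q] {D : WordData Q} {ι : Q → ℕ} {τ : Set ℕ} {S : Set Q}
  {q q' : Q} {j j' : ℕ}

/-- The index function is constant immediately to the right of each point. -/
def RightConst (ι : Q → ℕ) : Prop := ∀ p, ∃ p' > p, ∀ r ∈ Set.Ioo p p', ι r = ι p

variable (D ι τ S) in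
/-- Blocks of shape `τ` are available below the letters with first component in `S`. -/
def Avail : Prop :=
  (∃ n, τ = Set.Iio n) ∨ (τ = Set.univ ∧ ∀ p ∈ S, (D.color p).isRight → D.HasOmega (ι p))

lemma rightConst_const (D : WordData Q) (i : ℕ) : RightConst fun _ : Q ↦ i := fun p ↦
  let ⟨p', hp', _⟩ := D.exists_above (.inl 0) p
  ⟨p', hp', fun _ _ ↦ rfl⟩

lemma Avail.mono {S' : Set Q} (hτ : D.Avail ι τ S) (h : S' ⊆ S) : D.Avail ι τ S' :=
  hτ.imp_right fun ⟨huniv, hS⟩ ↦ ⟨huniv, fun p hp ↦ hS p (h hp)⟩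

lemma Avail.tail (hτ : D.Avail ι τ S) (hq : q ∈ S) (h : D.Full ι q j) (S' : Set Q) :
    D.Avail (fun _ ↦ ι q) τ S' := by
  obtain ⟨m, hm⟩ := h.exists_color
  exact hτ.imp_right fun ⟨huniv, hS⟩ ↦ ⟨huniv, fun _ _ _ ↦ hS q hq (hm ▸ rfl)⟩

/-! #### Roots in intervals -/

lemma exists_isRootOfShape_base (hι : RightConst ι) (hτ : D.Avail ι τ (Set.Icc q q'))
    (hq : q < q') : ∃ p ∈ Set.Ioo q q', IsRootOfShape τ (base D ι p) := by
  rcases hτ with ⟨n, rfl⟩ | ⟨rfl, homega⟩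
  · obtain ⟨p, hp, hp', hc⟩ := D.exists_between (.inl n) q q' hq
    exact ⟨p, ⟨hp, hp'⟩, isRoot_base p, blockShape_base_of_color_inl hc⟩
  · obtain ⟨p, hp, hp', hc⟩ := D.exists_between (.inr 0) q q' hq
    obtain ⟨m, hm⟩ := homega p ⟨hp.le, hp'.le⟩ (hc ▸ rfl)
    obtain ⟨r, hr, hconst⟩ := hι p
    obtain ⟨p', hpp', hp'r, hc'⟩ := D.exists_between (.inr m) p (min r q') (lt_min hr hp')
    have hιp : ι p' = ι p := hconst p' ⟨hpp', hp'r.trans_le (min_le_left _ _)⟩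
    exact ⟨p', ⟨hp.trans hpp', hp'r.trans_le (min_le_right _ _)⟩, isRoot_base p',
      blockShape_base_of_color_inr hc' (hιp ▸ hm)⟩

lemma exists_isRootOfShape_lt (hι : RightConst ι) (hτ : D.Avail ι τ Set.univ) (x : D.Words ι) :
    ∃ y, IsRootOfShape τ y ∧ BlockLT y x := by
  obtain ⟨q, hq, -⟩ := D.exists_below (.inl 0) (top x)
  obtain ⟨p, hp, hy⟩ := exists_isRootOfShape_base hι (hτ.mono (Set.subset_univ _)) hq
  exact ⟨_, hy, blockLT_of_top_lt hp.2⟩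

lemma exists_isRootOfShape_gt (hι : RightConst ι) (hτ : D.Avail ι τ Set.univ) (x : D.Words ι) :
    ∃ y, IsRootOfShape τ y ∧ BlockLT x y := by
  obtain ⟨q, hq, -⟩ := D.exists_above (.inl 0) (top x)
  obtain ⟨p, hp, hy⟩ := exists_isRootOfShape_base hι (hτ.mono (Set.subset_univ _)) hq
  exact ⟨_, hy, blockLT_of_top_lt hp.1⟩

lemma exists_isRootOfShape_lift_lt (h : D.Full ι q j) (hτ : D.Avail (fun _ ↦ ι q) τ Set.univ)
    (v : D.Tail ι q j) (hv : v.1 ≠ []) :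
    ∃ y, IsRootOfShape τ (lift q j h y) ∧ BlockLT (lift q j h y) (cons q j v) := by
  have hoc := ordConnected_range_lift h
  obtain ⟨x, hx⟩ := exists_eq_lift h v hv
  obtain ⟨y, hy, hyx⟩ := exists_isRootOfShape_lt (rightConst_const D (ι q)) hτ x
  exact ⟨y, isRootOfShape_orderEmbedding _ hoc hy,
    hx ▸ (blockLT_orderEmbedding_iff _ hoc).2 hyx⟩

lemma exists_isRootOfShape_lift_gt (h : D.Full ι q j) (hτ : D.Avail (fun _ ↦ ι q) τ Set.univ)
    (u : D.Tail ι q j) : ∃ y, IsRootOfShape τ (lift q j h y) ∧ cons q j u < lift q j h y := by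
  obtain ⟨x, hux⟩ := exists_lt_lift h u
  obtain ⟨y, hy, hxy⟩ := exists_isRootOfShape_gt (rightConst_const D (ι q)) hτ x
  exact ⟨y, isRootOfShape_orderEmbedding _ (ordConnected_range_lift h) hy,
    hux.trans ((lift q j h).lt_iff_lt.2 hxy.lt)⟩

lemma blockLT_lift_cons (h : D.Full ι q j) (y : D.Words fun _ ↦ ι q) (hj : j < j')
    (v : D.Tail ι q j') : BlockLT (lift q j h y) (cons q j' v) := fun k ↦ by
  rw [← orderEmbedding_spSucc_iterate _ (ordConnected_range_lift h)]
  exact cons_lt_cons_same_iff.2 (.inl hj)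

lemma exists_isRootOfShape_between_of_place_lt {u : D.Tail ι q j} {v : D.Tail ι q j'}
    (hτ : D.Avail ι τ S) (hq : q ∈ S) (hj : j < j') (hab : BlockLT (cons q j u) (cons q j' v)) :
    ∃ y, IsRootOfShape τ y ∧ cons q j u < y ∧ BlockLT y (cons q j' v) := by
  by_cases hv : D.Full ι q j' ∧ v.1 ≠ []
  · obtain ⟨y, hy, hyv⟩ := exists_isRootOfShape_lift_lt hv.1 (hτ.tail hq hv.1 _) v hv.2
    exact ⟨_, hy, cons_lt_cons_same_iff.2 (.inl hj), hyv⟩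
  · obtain ⟨i, rfl⟩ := Nat.exists_eq_succ_of_ne_zero hj.ne_bot
    have hfull : D.Full ι q i := by
      by_contra hi
      exact hab.infinite_Icc (finite_Icc_cons (fun l _ hl h ↦ hi (h.mono (Nat.le_of_lt_succ hl)))
        ((not_and_or.1 hv).imp_right not_not.1))
    have hτ' := hτ.tail hq hfull Set.univ
    obtain ⟨y, hy, huy⟩ : ∃ y, IsRootOfShape τ (lift q i hfull y) ∧
        cons q j u < lift q i hfull y := by
      rcases (Nat.le_of_lt_succ hj).eq_or_lt with rfl | hji
      · exact exists_isRootOfShape_lift_gt hfull hτ' u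
      · obtain ⟨y, hy, -⟩ := exists_isRootOfShape_lift_gt hfull hτ'
          ⟨[], trivial, hfull.nil_mem_fits i⟩
        exact ⟨y, hy, cons_lt_cons_same_iff.2 (.inl hji)⟩
    exact ⟨_, hy, huy, blockLT_lift_cons hfull y (Nat.lt_succ_self i) v⟩

lemma exists_isRootOfShape_between_of_letter_lt {u : D.Tail ι q j} {v : D.Tail ι q' j'}
    (hι : RightConst ι) (hτ : D.Avail ι τ (Set.Icc q q')) (h : q < q' ∨ q = q' ∧ j < j')
    (hab : BlockLT (cons q j u) (cons q' j' v)) :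
    ∃ y, IsRootOfShape τ y ∧ cons q j u < y ∧ BlockLT y (cons q' j' v) := by
  rcases h with hq | ⟨rfl, hj⟩
  · obtain ⟨p, hp, hy⟩ := exists_isRootOfShape_base hι hτ hq
    exact ⟨_, hy, lt_of_top_lt hp.1, blockLT_of_top_lt hp.2⟩
  · exact exists_isRootOfShape_between_of_place_lt hτ (Set.left_mem_Icc.2 le_rfl) hj hab

lemma exists_isRootOfShape_between (hι : RightConst ι) {a b : D.Words ι}
    (hτ : D.Avail ι τ (Set.Icc (top a) (top b))) (hab : BlockLT a b) :
    ∃ y, IsRootOfShape τ y ∧ a < y ∧ BlockLT y b := by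
  induction a using induction_lift with
  | lift ι q j h x ih =>
    obtain ⟨q', j', v, rfl⟩ := exists_eq_cons b
    rcases cons_lt_cons_iff.1 hab.lt with hq | ⟨hq, hj | ⟨rfl, hxv⟩⟩
    · exact exists_isRootOfShape_between_of_letter_lt hι hτ (.inl hq) hab
    · exact exists_isRootOfShape_between_of_letter_lt hι hτ (.inr ⟨hq, hj⟩) hab
    obtain rfl : q = q' := hq
    have hoc := ordConnected_range_lift h
    obtain ⟨z, hz⟩ := exists_eq_lift h v (ne_nil_of_lt hxv)
    rw [hz] at hab ⊢
    obtain ⟨y, hy, hxy, hyz⟩ := ih (rightConst_const D (ι q))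
      (hτ.tail (Set.left_mem_Icc.2 le_rfl) h _) ((blockLT_orderEmbedding_iff _ hoc).1 hab)
    exact ⟨lift q j h y, isRootOfShape_orderEmbedding _ hoc hy, (lift q j h).lt_iff_lt.2 hxy,
      (blockLT_orderEmbedding_iff _ hoc).2 hyz⟩
  | cons ι q j u hu =>
    obtain ⟨q', j', v, rfl⟩ := exists_eq_cons b
    rcases cons_lt_cons_iff.1 hab.lt with hq | ⟨hq, hj | ⟨rfl, huv⟩⟩
    · exact exists_isRootOfShape_between_of_letter_lt hι hτ (.inl hq) hab
    · exact exists_isRootOfShape_between_of_letter_lt hι hτ (.inr ⟨hq, hj⟩) hab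
    obtain rfl : q = q' := hq
    have hfull : D.Full ι q j := by
      by_contra hj
      exact hab.infinite_Icc (finite_Icc_cons (fun _ hi hi' ↦ absurd hi' hi.not_gt) (.inl hj))
    obtain ⟨u, hu'⟩ := u
    obtain rfl := hu.resolve_left (not_not_intro hfull)
    obtain ⟨y, hy, hyv⟩ := exists_isRootOfShape_lift_lt hfull
      (hτ.tail (Set.left_mem_Icc.2 le_rfl) hfull _) v (ne_nil_of_lt huv)
    exact ⟨_, hy, single_lt_lift hfull hu'.2 y, hyv⟩

/-! #### The extension property -/

variable (D ι) in
/-- Separators between the intervals on which a monotone index function is constant. -/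
structure Separators where
  /-- The point separating the indices up to `i` from the larger ones. -/
  sep : ℕ → Q
  le_iff : ∀ p i, ι p ≤ i ↔ p < sep i
  index_sep : ∀ i, ι (sep i) = i + 1
  color_sep : ∀ i, D.color (sep i) = .inl 0

namespace Separators

variable (s : Separators D ι)

include s

lemma monotone : Monotone ι := fun _ q hpq ↦
  (s.le_iff _ _).2 (hpq.trans_lt ((s.le_iff q _).1 le_rfl))

lemma rightConst : RightConst ι := fun p ↦
  ⟨s.sep (ι p), (s.le_iff _ _).1 le_rfl, fun _ hr ↦
    le_antisymm ((s.le_iff _ _).2 hr.2) (s.monotone hr.1.le)⟩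

lemma exists_interval (i : ℕ) : ∃ q q', q < q' ∧ ∀ p ∈ Set.Ioo q q', ι p = i := by
  cases i with
  | zero =>
    obtain ⟨q, hq, -⟩ := D.exists_below (.inl 0) (s.sep 0)
    exact ⟨q, s.sep 0, hq, fun p hp ↦ Nat.le_zero.1 ((s.le_iff _ _).2 hp.2)⟩
  | succ i =>
    refine ⟨s.sep i, s.sep (i + 1), (s.le_iff _ _).1 (s.index_sep i).le, fun p hp ↦ ?_⟩
    exact le_antisymm ((s.le_iff _ _).2 hp.2) (s.index_sep i ▸ s.monotone hp.1.le)

lemma exists_lt_of_index (i : ℕ) : ∃ q q', q < q' ∧ D.color q = .inl 0 ∧ D.color q' = .inl 0 ∧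
    ∀ p ∈ Set.Icc q q', ι p = i := by
  obtain ⟨r, r', hr, hι⟩ := s.exists_interval i
  obtain ⟨q, hq, hq', hc⟩ := D.exists_between (.inl 0) _ _ hr
  obtain ⟨q', hqq', hq'', hc'⟩ := D.exists_between (.inl 0) _ _ hq'
  exact ⟨q, q', hqq', hc, hc', fun p hp ↦ hι p ⟨hq.trans_le hp.1, hp.2.trans_lt hq''⟩⟩

lemma index_eq_of_split {N : ℕ} {x a b : D.Words ι} {p : Q} (hp : p ∈ Set.Icc (top a) (top b))
    (hpc : (D.color p).isRight) (hsplit : ∀ i < N,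
      (base D ι (s.sep i) ≤ a ∧ base D ι (s.sep i) < x) ∨
        (b ≤ base D ι (s.sep i) ∧ x < base D ι (s.sep i)))
    (hpN : ι p < N) : ι (top x) = ι p := by
  have hle : ∀ i < N, ι p ≤ i ↔ ι (top x) ≤ i := fun i hi ↦ by
    rw [s.le_iff, s.le_iff]
    rcases hsplit i hi with ⟨ha, hx⟩ | ⟨hb, hx⟩
    · exact iff_of_false ((monotone_top ha).trans hp.1).not_gt (monotone_top hx.le).not_gt
    · refine iff_of_true ((hp.2.trans (monotone_top hb)).lt_of_ne ?_)
        ((monotone_top hx.le).lt_of_ne ?_)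
      · intro hps
        change p = s.sep i at hps
        rw [hps, s.color_sep] at hpc
        exact Bool.false_ne_true hpc
      · intro hxs
        change top x = s.sep i at hxs
        exact hx.not_ge (hxs ▸ base_top_le x)
  have hxp := (hle _ hpN).1 le_rfl
  exact hxp.antisymm ((hle _ (hxp.trans_lt hpN)).2 le_rfl)

lemma hasSpExtension {N : ℕ} (hN : ∀ i ≥ N, D.HasOmega i) :
    HasSpExtension ((fun i ↦ base D ι (s.sep i)) '' Set.Iio N) := by
  refine hasSpExtension_of_exists_isRootOfShape exists_root fun x _ A B hA hB hAB hE ↦ ?_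
  have : Nonempty (D.Words ι) := ⟨x⟩
  obtain ⟨a, b, ha, hb, hab⟩ :=
    exists_blockLT_of_finite exists_blockLT_left exists_blockLT_right hA hB hAB
  have hτ : D.Avail ι (blockShape x) (Set.Icc (top a) (top b)) := by
    refine (blockShape_eq_Iio_or_eq_univ x).imp_right fun huniv ↦ ⟨huniv, fun p hp hpc ↦ ?_⟩
    by_cases hpN : ι p < N
    · rw [← s.index_eq_of_split hp hpc (fun i hi ↦ (hE _ ⟨i, hi, rfl⟩).imp
        (And.imp_left (ha _)) (And.imp_left (hb _))) hpN]
      by_contra hx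
      obtain ⟨k, hk⟩ := exists_notMem_blockShape x hx
      exact hk (huniv ▸ Set.mem_univ k)
    · exact hN _ (not_lt.1 hpN)
  obtain ⟨y, hy, hay, hyb⟩ := exists_isRootOfShape_between s.rightConst hτ hab
  exact ⟨y, hy, fun c hc ↦ (ha c hc).trans_lt hay, fun c hc ↦ hyb.trans_le (hb c hc)⟩

end Separators

lemma insert_base_mem_finiteSpPartialIsos {E : Set (D.Words ι)} {r : Set (D.Words ι × D.Words ι)}
    (hr : r ∈ finiteSpPartialIsos E) {k : ℕ} (hq : D.color q = .inl k) (hq' : D.color q' = .inl k)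
    (hlt : ∀ v ∈ r, top v.1 < q ∧ top v.2 < q') :
    insert (base D ι q, base D ι q') r ∈ finiteSpPartialIsos E := by
  refine insert_mem_finiteSpPartialIsos hr (hr.2.2.insert_of_separated ?_ fun v hv ↦ .inl
    ⟨blockLT_of_top_lt (hlt v hv).1, blockLT_of_top_lt (hlt v hv).2⟩)
  exact isSpPartialIso_singleton (isRoot_base q) (isRoot_base q')
    ((blockShape_base_of_color_inl hq).trans (blockShape_base_of_color_inl hq').symm)

/-- An interval of index `j` cannot be moved to an interval of index `i`, as only the former
contains a block of type `ω`. -/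
lemma Separators.not_hasSpExtension (s : Separators D ι) {E : Set (D.Words ι)} (hE : E.Finite)
    {i j : ℕ} (hi : ¬ D.HasOmega i) (hj : D.HasOmega j) (hEi : ∀ e ∈ E, ι (top e) < i)
    (hEj : ∀ e ∈ E, ι (top e) < j) : ¬ HasSpExtension E := fun hext ↦ by
  obtain ⟨a, b, hab, hac, hbc, hι⟩ := s.exists_lt_of_index i
  obtain ⟨a', b', hab', hac', hbc', hι'⟩ := s.exists_lt_of_index j
  obtain rfl := hι a (Set.left_mem_Icc.2 hab.le)
  obtain rfl := hι' a' (Set.left_mem_Icc.2 hab'.le)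
  obtain ⟨p, hp, -, hshape⟩ := exists_isRootOfShape_base (D := D) s.rightConst
    (.inr ⟨rfl, fun p hp _ ↦ (hι' p hp).symm ▸ hj⟩) hab'
  have hdiag : (fun e ↦ (e, e)) '' E ∈ finiteSpPartialIsos E := by
    refine ⟨hE.image _, fun e he ↦ ⟨e, he, rfl⟩, (isSpPartialIso_graph (.refl _)).mono ?_⟩
    rintro _ ⟨e, -, rfl⟩
    rfl
  have hr : insert (base D ι a', base D ι a) ((fun e ↦ (e, e)) '' E) ∈ finiteSpPartialIsos E := by
    refine insert_base_mem_finiteSpPartialIsos hdiag hac' hac ?_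
    rintro _ ⟨e, he, rfl⟩
    exact ⟨s.monotone.reflect_lt (hEj e he), s.monotone.reflect_lt (hEi e he)⟩
  have hr' := insert_base_mem_finiteSpPartialIsos hr hbc' hbc <| by
    rintro _ (rfl | ⟨e, he, rfl⟩)
    · exact ⟨hab', hab⟩
    · exact ⟨(s.monotone.reflect_lt (hEj e he)).trans hab',
        (s.monotone.reflect_lt (hEi e he)).trans hab⟩
  obtain ⟨d, hd⟩ := hext _ hr' (base D ι p)
  have had : base D ι a < d := (hd.lt_iff (.inr (.inr (.inl rfl))) (.inl rfl)).1 (lt_of_top_lt hp.1)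
  have hdb : d < base D ι b := (hd.lt_iff (.inl rfl) (.inr (.inl rfl))).1 (lt_of_top_lt hp.2)
  obtain ⟨k, hk⟩ := exists_notMem_blockShape d
    (hι _ ⟨monotone_top had.le, monotone_top hdb.le⟩ ▸ hi)
  have hshape' := hd.blockShape_eq (.inl rfl)
  exact hk (hshape'.symm.trans hshape ▸ Set.mem_univ k)

lemma Separators.hasSpExtension_empty_iff (s : Separators D ι)
    (hfreq : ∃ᶠ i in Filter.atTop, D.HasOmega i) :
    HasSpExtension (∅ : Set (D.Words ι)) ↔ ∀ i, D.HasOmega i := by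
  refine ⟨fun h i ↦ ?_, fun h ↦ ?_⟩
  · by_contra hi
    obtain ⟨j, hj⟩ := hfreq.exists
    exact s.not_hasSpExtension Set.finite_empty hi hj (fun _ ↦ False.elim) (fun _ ↦ False.elim) h
  · have hempty := s.hasSpExtension (N := 0) fun i _ ↦ h i
    rwa [show Set.Iio 0 = ∅ from Set.Iio_bot, Set.image_empty] at hempty

lemma Separators.exists_hasSpExtension_iff (s : Separators D ι)
    (hfreq : ∃ᶠ i in Filter.atTop, D.HasOmega i) :
    (∃ E : Finset (D.Words ι), HasSpExtension (E : Set (D.Words ι))) ↔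
      ∀ᶠ i in Filter.atTop, D.HasOmega i := by
  refine ⟨fun ⟨E, h⟩ ↦ ?_, fun h ↦ ?_⟩
  · by_contra hfin
    let M := E.sup fun e ↦ ι (top e)
    have hM : ∀ e ∈ E, ι (top e) ≤ M := fun e he ↦ Finset.le_sup (f := fun e ↦ ι (top e)) he
    obtain ⟨i, hi, hi'⟩ := Filter.frequently_atTop.1 (Filter.not_eventually.1 hfin) (M + 1)
    obtain ⟨j, hj, hj'⟩ := Filter.frequently_atTop.1 hfreq (M + 1)
    exact s.not_hasSpExtension E.finite_toSet hi' hj' (fun e he ↦ (hM e he).trans_lt hi)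
      (fun e he ↦ (hM e he).trans_lt hj) h
  · obtain ⟨N, hN⟩ := Filter.eventually_atTop.1 h
    have hfin := (Set.finite_Iio N).image fun i ↦ base D ι (s.sep i)
    exact ⟨hfin.toFinset, hfin.coe_toFinset.symm ▸ s.hasSpExtension hN⟩

end WordData

/-! ### Indices of computably enumerable suborders -/

section Enumeration

variable {α : Type u} {β : Type v} [Primcodable α] [Primcodable β]

@[fun_prop]
lemma computable_encode_comp {f : α → β} (hf : Computable f) :
    Computable fun a ↦ Encodable.encode (f a) :=
  Computable.encode.comp hf

section Nth

variable {p : α → ℕ → Prop} (hp : ComputablePred fun x : α × ℕ ↦ p x.1 x.2)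

include hp

lemma computable_count [∀ a, DecidablePred (p a)] :
    Computable fun x : α × ℕ ↦ Nat.count (p x.1) x.2 := by
  obtain ⟨f, hf, hfp⟩ := computablePred_iff_exists_bool.1 hp
  refine (Computable.nat_rec (f := fun x : α × ℕ ↦ x.2) (g := fun _ ↦ 0)
    (h := fun x y ↦ y.2 + bif f (x.1, y.1) then 1 else 0) (by fun_prop) (by fun_prop)
    (computable_add_comp (by fun_prop) (Computable.cond (hf.comp (by fun_prop))
      (Computable.const 1) (Computable.const 0)))).of_eq ?_
  rintro ⟨a, n⟩
  induction n with
  | zero => simp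
  | succ n ih =>
    have hpf : p a n ↔ f (a, n) = true := hfp (a, n)
    simp only at ih
    simp only [Nat.count_succ, ← ih, hpf, Bool.cond_eq_ite]

lemma computable_nth (hinf : ∀ a, {n | p a n}.Infinite) :
    Computable fun x : α × ℕ ↦ Nat.nth (p x.1) x.2 := by
  classical
  have hindex : ComputablePred fun y : (α × ℕ) × ℕ ↦
      p y.1.1 y.2 ∧ Nat.count (p y.1.1) y.2 = y.1.2 :=
    computablePred_and
      (computablePred_comp (f := fun y : (α × ℕ) × ℕ ↦ (y.1.1, y.2)) hp (by fun_prop))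
      (computablePred_eq ((computable_count hp).comp
        (g := fun y : (α × ℕ) × ℕ ↦ (y.1.1, y.2)) (by fun_prop)) (by fun_prop))
  obtain ⟨g, hg, hgp⟩ := computablePred_iff_exists_bool.1 hindex
  have hpart : Partrec₂ fun (x : α × ℕ) (n : ℕ) ↦ (Part.some (g (x, n)) : Part Bool) := hg.partrec
  refine (Partrec.rfind hpart).of_eq fun x ↦ Part.eq_some_iff.2 (Nat.mem_rfind.2 ⟨?_, ?_⟩)
  · exact Part.mem_some_iff.2 ((hgp (x, _)).1
      ⟨Nat.nth_mem_of_infinite (hinf x.1) x.2, Nat.count_nth_of_infinite (hinf x.1) x.2⟩).symm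
  · intro m hm
    refine Part.mem_some_iff.2 (Eq.symm <| Bool.eq_false_iff.2 fun h ↦ ?_)
    obtain ⟨hpm, hcount⟩ := (hgp (x, m)).2 h
    exact hm.ne ((Nat.nth_count hpm).symm.trans (congrArg _ hcount))

end Nth

lemma SigmaPred.exists_unique_witness {p : α → Prop} (hp : SigmaPred 1 p) :
    ∃ q : α → ℕ → Prop, ComputablePred (fun x : α × ℕ ↦ q x.1 x.2) ∧
      (∀ x, p x ↔ ∃ y, q x y) ∧ ∀ x y y', q x y → q x y' → y = y' := by
  classical
  obtain ⟨q, hq, hpq⟩ := hp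
  refine ⟨fun x y ↦ q (x, y) ∧ ∀ t < y, ¬ q (x, t),
    computablePred_and (piPred_zero_iff.1 hq) (computablePred_ball_lt (p := fun x t ↦ ¬ q (x, t))
      (piPred_zero_iff.1 hq).not), fun x ↦ ?_, fun x y y' h h' ↦ ?_⟩
  · rw [hpq]
    exact ⟨fun h ↦ ⟨Nat.find h, Nat.find_spec h, fun _ ↦ Nat.find_min h⟩,
      fun ⟨y, hy, _⟩ ↦ ⟨y, hy⟩⟩
  · exact le_antisymm (not_lt.1 fun hlt ↦ h.2 _ hlt h'.1) (not_lt.1 fun hlt ↦ h'.2 _ hlt h.1)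

lemma SigmaPred.exists_enumeration [Inhabited β] {S : α → β → Prop}
    (hS : SigmaPred 1 fun x : α × β ↦ S x.1 x.2) (hinf : ∀ a, {b | S a b}.Infinite) :
    ∃ F : α → ℕ → β, Computable (fun x : α × ℕ ↦ F x.1 x.2) ∧
      ∀ a, Function.Injective (F a) ∧ Set.range (F a) = {b | S a b} := by
  obtain ⟨q, hq, hSq, huniq⟩ := hS.exists_unique_witness
  let val (n : ℕ) : β := (Encodable.decode n.unpair.1).getD default
  have hval : Computable val :=
    Primrec.option_getD_default.to_comp.comp (Computable.decode.comp (by fun_prop))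
  let G (a : α) (n : ℕ) : Prop :=
    Encodable.encode (val n) = n.unpair.1 ∧ q (a, val n) n.unpair.2
  have hG : ComputablePred fun x : α × ℕ ↦ G x.1 x.2 :=
    computablePred_and (computablePred_eq (by fun_prop) (by fun_prop))
      (computablePred_comp (f := fun x : α × ℕ ↦ ((x.1, val x.2), x.2.unpair.2)) hq
        (by fun_prop))
  have himage (a : α) : val '' {n | G a n} = {b | S a b} := by
    refine Set.Subset.antisymm ?_ fun b hb ↦ ?_
    · rintro _ ⟨n, hn, rfl⟩
      exact (hSq (a, val n)).2 ⟨_, hn.2⟩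
    · obtain ⟨y, hy⟩ := (hSq (a, b)).1 hb
      have hb : val (Nat.pair (Encodable.encode b) y) = b := by simp [val]
      exact ⟨_, ⟨by rw [hb, Nat.unpair_pair], by rwa [hb, Nat.unpair_pair]⟩, hb⟩
  have hinj (a : α) : Set.InjOn val {n | G a n} := fun n hn n' hn' h ↦ by
    rw [← Nat.pair_unpair n, ← Nat.pair_unpair n', ← hn.1, ← hn'.1,
      huniq _ _ _ hn.2 (h ▸ hn'.2), h]
  have hGinf (a : α) : {n | G a n}.Infinite := .of_image val (himage a ▸ hinf a)
  refine ⟨fun a k ↦ val (Nat.nth (G a) k), hval.comp (computable_nth hG hGinf), fun a ↦ ⟨?_, ?_⟩⟩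
  · exact fun k k' h ↦ Nat.nth_injective (hGinf a) (hinj a (Nat.nth_mem_of_infinite (hGinf a) k)
      (Nat.nth_mem_of_infinite (hGinf a) k') h)
  · rw [← himage, ← Nat.range_nth_of_infinite (hGinf a), ← Set.range_comp]
    rfl

lemma exists_computable_index {r : ℕ → ℕ → ℕ → Prop}
    (hr : ComputablePred fun x : ℕ × ℕ × ℕ ↦ r x.1 x.2.1 x.2.2) :
    ∃ e : ℕ → ℕ, Computable e ∧ ∀ (x : ℕ) (o : LinearOrder ℕ),
      (∀ a b, o.le a b ↔ r x a b) → DefinesLinearOrder (e x) o := by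
  obtain ⟨f, hf, hfr⟩ := computablePred_iff_exists_bool.1 hr
  let g (n : ℕ) : ℕ := bif f (n.unpair.1, n.unpair.2.unpair) then 1 else 0
  have hg : Computable g :=
    Computable.cond (hf.comp (by fun_prop)) (Computable.const 1) (Computable.const 0)
  obtain ⟨c, hc⟩ := Nat.Partrec.Code.exists_code.1 (Partrec.nat_iff.1 hg.partrec)
  refine ⟨fun x ↦ Encodable.encode (c.curry x), ?_, fun x o ho a b ↦ ?_⟩
  · exact Computable.encode.comp
      (Nat.Partrec.Code.primrec₂_curry.to_comp.comp (Computable.const c) Computable.id)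
  · have hle : o.le a b ↔ f (x, a, b) = true := (ho a b).trans (hfr (x, a, b))
    rw [phi, Denumerable.ofNat_encode, Nat.Partrec.Code.eval_curry, hc]
    simp [g, hle, Bool.cond_eq_ite]

lemma exists_index_of_suborder [Inhabited β] [LinearOrder β]
    (hle : ComputablePred fun x : β × β ↦ x.1 ≤ x.2) {S : ℕ → β → Prop}
    (hS : SigmaPred 1 fun x : ℕ × β ↦ S x.1 x.2) (hinf : ∀ x, {u | S x u}.Infinite) :
    ∃ e : ℕ → ℕ, Computable e ∧
      ∀ x, IsOrderIndex (e x) ∧ Nonempty (IndexedOrder (e x) ≃o {u // S x u}) := by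
  obtain ⟨F, hF, hFS⟩ := hS.exists_enumeration hinf
  obtain ⟨e, he, heF⟩ := exists_computable_index (r := fun x a b ↦ F x a ≤ F x b)
    (computablePred_comp hle (f := fun x : ℕ × ℕ × ℕ ↦ (F x.1 x.2.1, F x.1 x.2.2))
      ((hF.comp (g := fun x : ℕ × ℕ × ℕ ↦ (x.1, x.2.1)) (by fun_prop)).pair
        (hF.comp (g := fun x : ℕ × ℕ × ℕ ↦ (x.1, x.2.2)) (by fun_prop))))
  refine ⟨e, he, fun x ↦ exists_definesLinearOrder_and_iff
    (P := fun o ↦ Nonempty (@OrderIso ℕ {u // S x u} o.toLE _)) |>.1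
    ⟨.lift' (F x) (hFS x).1, heF x _ fun _ _ ↦ Iff.rfl, ⟨?_⟩⟩⟩
  letI : LinearOrder ℕ := .lift' (F x) (hFS x).1
  exact
    { toEquiv := (Equiv.ofInjective _ (hFS x).1).trans (Equiv.setCongr (hFS x).2)
      map_rel_iff' := Iff.rfl }

end Enumeration

/-! ### A computable dense order -/

section ListOrder

variable {γ : Type v} [LinearOrder γ]

lemma list_lt_iff_exists_take (d : γ) (l l' : List γ) : l < l' ↔ ∃ i < l'.length,
    l.take i = l'.take i ∧ (l.length ≤ i ∨ l.getD i d < l'.getD i d) := by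
  induction l generalizing l' with
  | nil => cases l' <;> simp
  | cons a l ih =>
    cases l' with
    | nil => simp
    | cons b l' =>
      rw [List.cons_lt_cons_iff, ih, List.length_cons (as := l'), Nat.exists_lt_succ_left]
      simp [and_assoc, ← exists_and_left, and_left_comm]

lemma list_lt_append_cons (l : List γ) (a : γ) (l' : List γ) : l < l ++ a :: l' := by
  induction l with
  | nil => exact List.nil_lt_cons _ _
  | cons b l ih => exact List.cons_lt_cons_iff.2 (.inr ⟨rfl, ih⟩)

lemma exists_list_between {l l' : List ℕ} {k : ℕ} (h : l < l' ++ [k + 1]) :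
    ∃ m ≠ [], ∀ n, l < m ++ [n] ∧ m ++ [n] < l' ++ [k + 1] := by
  have of_head_lt {a b : ℕ} (u w : List ℕ) (hab : a < b) :
      ∃ m ≠ [], ∀ n, a :: u < m ++ [n] ∧ m ++ [n] < b :: w :=
    ⟨a :: u, List.cons_ne_nil _ _, fun n ↦ ⟨list_lt_append_cons _ _ _,
      List.cons_lt_cons_iff.2 (.inl hab)⟩⟩
  induction l' generalizing l with
  | nil =>
    rcases l with _ | ⟨a, u⟩
    · exact ⟨[0], List.cons_ne_nil _ _, fun n ↦ ⟨List.nil_lt_cons _ _,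
        List.cons_lt_cons_iff.2 (.inl k.succ_pos)⟩⟩
    · exact of_head_lt _ _ ((List.cons_lt_cons_iff.1 h).resolve_right
        fun h ↦ List.not_lt_nil _ h.2)
  | cons b l' ih =>
    rcases l with _ | ⟨a, u⟩
    · obtain ⟨m, -, hm⟩ := ih (l := []) (by cases l' <;> exact List.nil_lt_cons _ _)
      exact ⟨b :: m, List.cons_ne_nil _ _, fun n ↦ ⟨List.nil_lt_cons _ _,
        List.cons_lt_cons_iff.2 (.inr ⟨rfl, (hm n).2⟩)⟩⟩
    · rcases List.cons_lt_cons_iff.1 h with hab | ⟨rfl, hu⟩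
      · exact of_head_lt _ _ hab
      · obtain ⟨m, -, hm⟩ := ih hu
        exact ⟨a :: m, List.cons_ne_nil _ _, fun n ↦
          ⟨List.cons_lt_cons_iff.2 (.inr ⟨rfl, (hm n).1⟩),
            List.cons_lt_cons_iff.2 (.inr ⟨rfl, (hm n).2⟩)⟩⟩

end ListOrder

section ComputableListOrder

variable {α : Type u} {γ : Type v} [Primcodable α] [Primcodable γ]

@[fun_prop]
lemma computable_take_comp {f : α → ℕ} {g : α → List γ} (hf : Computable f) (hg : Computable g) :
    Computable fun a ↦ (g a).take (f a) :=
  Primrec.list_take.to_comp.comp hf hg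

lemma computablePred_list_le [LinearOrder γ] [Inhabited γ]
    (hle : ComputablePred fun x : γ × γ ↦ x.1 ≤ x.2) :
    ComputablePred fun x : List γ × List γ ↦ x.1 ≤ x.2 := by
  have hpos : ComputablePred fun y : (List γ × List γ) × ℕ ↦ ¬ (y.1.2.take y.2 = y.1.1.take y.2 ∧
      (y.1.2.length ≤ y.2 ∨ ¬ y.1.1.getD y.2 default ≤ y.1.2.getD y.2 default)) :=
    (computablePred_and (computablePred_eq (by fun_prop) (by fun_prop))
      (computablePred_or (computablePred_le (by fun_prop) (by fun_prop))
        (computablePred_comp (f := fun y : (List γ × List γ) × ℕ ↦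
          (y.1.1.getD y.2 default, y.1.2.getD y.2 default)) hle (by fun_prop)).not)).not
  refine (computablePred_comp (f := fun x : List γ × List γ ↦ (x, x.1.length))
    (computablePred_ball_lt (p := fun (x : List γ × List γ) i ↦ ¬ (x.2.take i = x.1.take i ∧
      (x.2.length ≤ i ∨ ¬ x.1.getD i default ≤ x.2.getD i default))) hpos) (by fun_prop)).of_eq
    fun x ↦ ?_
  rw [← not_lt, list_lt_iff_exists_take default]
  simp only [not_exists, not_and, not_le]

end ComputableListOrder

/-- Nonempty lists of natural numbers with nonzero last entry, ordered lexicographically: a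
computable copy of the order of the rationals. The pair `(l, k)` encodes the list `l ++ [k + 1]`. -/
def LexSeq : Type := List ℕ × ℕ

namespace LexSeq

/-- The list encoded by an element of `LexSeq`. -/
def toList (q : LexSeq) : List ℕ := q.1 ++ [q.2 + 1]

lemma toList_injective : Function.Injective toList := fun _ _ h ↦
  Prod.ext_iff.2 ⟨(List.append_inj' h rfl).1, Nat.succ_injective
    (List.head_eq_of_cons_eq (List.append_inj' h rfl).2)⟩

instance : LinearOrder LexSeq := LinearOrder.lift' toList toList_injective

instance : Primcodable LexSeq := inferInstanceAs (Primcodable (List ℕ × ℕ))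

instance : Inhabited LexSeq := ⟨([], 0)⟩

/-- The first entry of the list. -/
def index (q : LexSeq) : ℕ := q.toList.getD 0 0

/-- Lists of length one have colour `Sum.inl 0`; the colour of a longer list is the one encoded by
its last entry. -/
def color (q : LexSeq) : ℕ ⊕ ℕ := if q.1 = [] then .inl 0 else (Encodable.decode q.2).getD (.inl 0)

/-- The list `[i + 1]`, where the index jumps from `i` to `i + 1`. -/
def sep (i : ℕ) : LexSeq := ([], i)

lemma computable_toList : Computable toList :=
  Primrec.list_append.to_comp.comp (Computable.fst (α := List ℕ) (β := ℕ)) (computable_cons_comp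
    (computable_add_comp (Computable.snd (α := List ℕ) (β := ℕ)) (Computable.const 1))
    (Computable.const []))

lemma computable_index : Computable index := computable_getD_comp computable_toList (.const 0) 0

lemma computable_color : Computable color :=
  (Primrec.ite (Primrec.eq.comp (Primrec.fst (α := List ℕ) (β := ℕ)) (Primrec.const []))
    (Primrec.const (Sum.inl 0)) (Primrec.option_getD.comp (Primrec.decode.comp Primrec.snd)
      (Primrec.const (Sum.inl 0)))).to_comp

lemma computablePred_le : ComputablePred fun x : LexSeq × LexSeq ↦ x.1 ≤ x.2 :=
  computablePred_comp (f := fun x : LexSeq × LexSeq ↦ (x.1.toList, x.2.toList))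
    (computablePred_list_le (_root_.computablePred_le .fst .snd))
    ((computable_toList.comp .fst).pair (computable_toList.comp .snd))

lemma exists_of_color (c : ℕ ⊕ ℕ) {l : List ℕ} (hl : l ≠ []) :
    ∃ q : LexSeq, q.color = c ∧ ∃ n, q.toList = l ++ [n] :=
  ⟨(l, Encodable.encode c), by simp [color, hl], _, rfl⟩

lemma exists_between (c : ℕ ⊕ ℕ) {l : List ℕ} {q : LexSeq} (h : l < q.toList) :
    ∃ p : LexSeq, l < p.toList ∧ p < q ∧ p.color = c := by
  obtain ⟨m, hm, hlt⟩ := exists_list_between h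
  obtain ⟨p, hp, n, hpn⟩ := exists_of_color c hm
  exact ⟨p, hpn ▸ (hlt n).1, (hpn ▸ (hlt n).2 : p.toList < q.toList), hp⟩

lemma exists_below (c : ℕ ⊕ ℕ) (q : LexSeq) : ∃ p < q, p.color = c := by
  have hnil : [] < q.toList := by
    obtain ⟨_ | _, _⟩ := q <;> exact List.nil_lt_cons _ _
  obtain ⟨p, -, hp⟩ := exists_between c hnil
  exact ⟨p, hp⟩

lemma exists_above (c : ℕ ⊕ ℕ) (q : LexSeq) : ∃ p > q, p.color = c := by
  obtain ⟨p, hp, n, hpn⟩ := exists_of_color c (l := q.toList) (by simp [toList])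
  exact ⟨p, (hpn ▸ list_lt_append_cons _ _ _ : q.toList < p.toList), hp⟩

lemma index_le_iff (p : LexSeq) (i : ℕ) : p.index ≤ i ↔ p < sep i := by
  change _ ↔ p.toList < [i + 1]
  rw [index]
  obtain ⟨a, l, h⟩ : ∃ a l, p.toList = a :: l := List.exists_cons_of_ne_nil (by simp [toList])
  simp [h, List.cons_lt_cons_iff]

end LexSeq

/-! ### The order of words of a `Σ⁰₄` predicate -/

namespace WordData

variable {Q : Type*} [LinearOrder Q] {D : WordData Q} {ι : Q → ℕ}

lemma mem_fits_iff {q : Q} {j : ℕ} {u : List (Q ×ₗ ℕ)} : u ∈ D.fits ι q j ↔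
    (∃ k, D.color q = .inl k ∧ j ≤ k ∧ u = []) ∨
      ∃ m, D.color q = .inr m ∧ u ∈ D.tails (ι q) m j := by
  rcases hc : D.color q with k | m
  · simp [fits_of_color_inl hc]
  · simp [fits_of_color_inr hc]

lemma valid_const_iff (d : Q ×ₗ ℕ) (i : ℕ) (u : List (Q ×ₗ ℕ)) :
    D.Valid (fun _ ↦ i) u ↔ ∀ t < u.length,
      u.drop (t + 1) ∈ D.fits (fun _ ↦ i) (ofLex (u.getD t d)).1 (ofLex (u.getD t d)).2 := by
  induction u with
  | nil => simp [Valid]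
  | cons a u ih =>
    rw [Valid, ih, List.length_cons, Nat.forall_lt_succ_left, and_comm]
    simp

lemma valid_iff (d : Q ×ₗ ℕ) (u : List (Q ×ₗ ℕ)) : D.Valid ι u ↔ ∀ t < u.length,
    u.drop (t + 1) ∈ D.fits (fun _ ↦ ι (ofLex (u.getD 0 d)).1) (ofLex (u.getD t d)).1
      (ofLex (u.getD t d)).2 := by
  rw [← valid_const_iff]
  cases u <;> rfl

end WordData

/-- The letters of words over `LexSeq`. -/
abbrev LexLetter : Type := LexSeq ×ₗ ℕ

instance : Primcodable LexLetter := inferInstanceAs (Primcodable (LexSeq × ℕ))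

instance : Inhabited LexLetter := ⟨toLex (default, 0)⟩

/-- All numbers below `n` are rejected at one of the places up to `j`. Here `R i m j y` says that
`y` is rejected at place `j`. -/
def Rejected (R : ℕ → ℕ → ℕ → ℕ → Prop) (i m j n : ℕ) : Prop := ∃ j' ≤ j, ∀ y < n, R i m j' y

section Rejected

variable {R : ℕ → ℕ → ℕ → ℕ → Prop} {i m j j' n n' : ℕ}

lemma rejected_zero : Rejected R i m j 0 :=
  ⟨0, Nat.zero_le _, fun _ h ↦ absurd h (Nat.not_lt_zero _)⟩

lemma Rejected.mono (hj : j ≤ j') (h : Rejected R i m j n) : Rejected R i m j' n :=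
  let ⟨j₀, hj₀, H⟩ := h
  ⟨j₀, hj₀.trans hj, H⟩

lemma Rejected.antitone (hn : n ≤ n') (h : Rejected R i m j n') : Rejected R i m j n :=
  let ⟨j₀, hj₀, H⟩ := h
  ⟨j₀, hj₀, fun y hy ↦ H y (hy.trans_le hn)⟩

lemma forall_exists_not_rejected_iff :
    (∀ j, ∃ n, ¬ Rejected R i m j n) ↔ ∀ j, ∃ y, ¬ R i m j y := by
  simp only [Rejected, not_exists, not_and, not_forall]
  constructor
  · intro h j
    obtain ⟨n, hn⟩ := h j
    obtain ⟨y, -, hy⟩ := hn j le_rfl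
    exact ⟨y, hy⟩
  · intro h j
    choose f hf using h
    exact ⟨(Finset.range (j + 1)).sup f + 1, fun j' hj' ↦ ⟨f j', Nat.lt_succ_of_le
      (Finset.le_sup (Finset.mem_range.2 (Nat.lt_succ_of_le hj'))), hf j'⟩⟩

end Rejected

lemma finite_setOf_encode_lt {β : Type*} [Encodable β] (n : ℕ) :
    {b : β | Encodable.encode b < n}.Finite :=
  (Set.finite_Iio n).preimage Encodable.encode_injective.injOn

/-- The word data of the predicate `∃ m, ∀ j, ∃ y, ¬ R i m j y`: tails are admitted according to
their codes. -/
def rejectionWordData (R : ℕ → ℕ → ℕ → ℕ → Prop) : WordData LexSeq where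
  color := LexSeq.color
  exists_between c _ _ h := LexSeq.exists_between c h
  exists_below := LexSeq.exists_below
  exists_above := LexSeq.exists_above
  tails i m j := {u : List LexLetter | Rejected R i m j (Encodable.encode u)}
  nil_mem_tails _ _ _ := rejected_zero
  tails_mono _ _ _ _ hj _ h := h.mono hj
  finite_tails i m j h := by
    obtain ⟨u, hu⟩ := (Set.ne_univ_iff_exists_notMem _).1 h
    exact (finite_setOf_encode_lt (Encodable.encode u)).subset fun v hv ↦
      lt_of_not_ge fun huv ↦ hu (hv.antitone huv)

/-- The lists `[i + 1]` separate the indices. -/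
def rejectionSeparators (R : ℕ → ℕ → ℕ → ℕ → Prop) :
    (rejectionWordData R).Separators LexSeq.index where
  sep := LexSeq.sep
  le_iff := LexSeq.index_le_iff
  index_sep _ := rfl
  color_sep _ := rfl

lemma hasOmega_rejectionWordData_iff (R : ℕ → ℕ → ℕ → ℕ → Prop) (i : ℕ) :
    (rejectionWordData R).HasOmega i ↔ ∃ m, ∀ j, ∃ y, ¬ R i m j y := by
  refine exists_congr fun m ↦ Iff.trans (forall_congr' fun j ↦ ?_) forall_exists_not_rejected_iff
  rw [Set.ne_univ_iff_exists_notMem]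
  constructor
  · exact fun ⟨_, hu⟩ ↦ ⟨_, hu⟩
  · rintro ⟨n, hn⟩
    obtain ⟨u, hu⟩ := (finite_setOf_encode_lt (β := List LexLetter) n).exists_notMem
    exact ⟨u, fun h ↦ hn (h.antitone (not_lt.1 hu))⟩

section Computability

variable {α : Type u} [Primcodable α]

@[fun_prop]
lemma computable_drop_comp {β : Type v} [Primcodable β] {f : α → ℕ} {g : α → List β}
    (hf : Computable f) (hg : Computable g) : Computable fun a ↦ (g a).drop (f a) :=
  Primrec.list_drop.to_comp.comp hf hg

lemma computable_ofLex_fst_comp {f : α → LexLetter} (hf : Computable f) :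
    Computable fun a ↦ (ofLex (f a)).1 :=
  (Computable.fst (α := LexSeq) (β := ℕ)).comp hf

lemma computable_ofLex_snd_comp {f : α → LexLetter} (hf : Computable f) :
    Computable fun a ↦ (ofLex (f a)).2 :=
  (Computable.snd (α := LexSeq) (β := ℕ)).comp hf

lemma computablePred_word_le :
    ComputablePred fun x : List LexLetter × List LexLetter ↦ x.1 ≤ x.2 := by
  refine computablePred_list_le ?_
  simp only [Prod.Lex.le_iff, ← not_le (α := LexSeq)]
  refine computablePred_or ?_ (computablePred_and ?_ ?_)
  · exact (computablePred_comp (f := fun x : LexLetter × LexLetter ↦ ((ofLex x.2).1, (ofLex x.1).1))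
      LexSeq.computablePred_le ((computable_ofLex_fst_comp .snd).pair
        (computable_ofLex_fst_comp .fst))).not
  · exact computablePred_eq (computable_ofLex_fst_comp .fst) (computable_ofLex_fst_comp .snd)
  · exact computablePred_le (computable_ofLex_snd_comp .fst) (computable_ofLex_snd_comp .snd)

variable {R : ℕ → ℕ → ℕ → ℕ → ℕ → Prop}
  (hR : SigmaPred 1 fun x : ℕ × ℕ × ℕ × ℕ × ℕ ↦ R x.1 x.2.1 x.2.2.1 x.2.2.2.1 x.2.2.2.2)

include hR

lemma sigmaPred_rejected {x i m j n : α → ℕ} (hx : Computable x) (hi : Computable i)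
    (hm : Computable m) (hj : Computable j) (hn : Computable n) :
    SigmaPred 1 fun a ↦ Rejected (R (x a)) (i a) (m a) (j a) (n a) := by
  refine .exists (.and (.of_computable (computablePred_le (by fun_prop) (by fun_prop))) ?_)
  exact SigmaPred.comp (f := fun b : α × ℕ ↦ (b, n b.1))
    (SigmaPred.ball_lt (p := fun (b : α × ℕ) y ↦ R (x b.1) (i b.1) (m b.1) b.2 y)
      (hR.comp (f := fun c : (α × ℕ) × ℕ ↦ (x c.1.1, i c.1.1, m c.1.1, c.1.2, c.2))
        (by fun_prop))) (by fun_prop)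

lemma sigmaPred_mem_fits {x i j : α → ℕ} {q : α → LexSeq} {u : α → List LexLetter}
    (hx : Computable x) (hi : Computable i) (hj : Computable j) (hq : Computable q)
    (hu : Computable u) : SigmaPred 1 fun a ↦
      u a ∈ (rejectionWordData (R (x a))).fits (fun _ ↦ i a) (q a) (j a) := by
  refine SigmaPred.of_iff (.or (.exists_nat ?_) (.exists_nat ?_)) fun a ↦ WordData.mem_fits_iff
  · exact .of_computable (computablePred_and
      (computablePred_eq (LexSeq.computable_color.comp (by fun_prop))
        (Primrec.sumInl.to_comp.comp .snd))
      (computablePred_and (computablePred_le (by fun_prop) (by fun_prop))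
        (computablePred_eq (by fun_prop) (by fun_prop))))
  · exact .and (.of_computable (computablePred_eq (LexSeq.computable_color.comp (by fun_prop))
        (Primrec.sumInr.to_comp.comp .snd)))
      (sigmaPred_rejected hR (by fun_prop) (by fun_prop) (by fun_prop) (by fun_prop)
        (by fun_prop))

lemma sigmaPred_words : SigmaPred 1 fun p : ℕ × List LexLetter ↦
    p.2 ≠ [] ∧ (rejectionWordData (R p.1)).Valid LexSeq.index p.2 := by
  refine .and (.of_computable (computablePred_eq (by fun_prop) (by fun_prop)).not) ?_
  have hfits : SigmaPred 1 fun c : (ℕ × List LexLetter) × ℕ ↦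
      c.1.2.drop (c.2 + 1) ∈ (rejectionWordData (R c.1.1)).fits
        (fun _ ↦ LexSeq.index (ofLex (c.1.2.getD 0 default)).1)
        (ofLex (c.1.2.getD c.2 default)).1 (ofLex (c.1.2.getD c.2 default)).2 := by
    refine sigmaPred_mem_fits hR (by fun_prop) (LexSeq.computable_index.comp ?_) ?_ ?_ (by fun_prop)
    · exact computable_ofLex_fst_comp (by fun_prop)
    · exact computable_ofLex_snd_comp (by fun_prop)
    · exact computable_ofLex_fst_comp (by fun_prop)
  have hball := SigmaPred.ball_lt (p := fun (x : ℕ × List LexLetter) t ↦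
    x.2.drop (t + 1) ∈ (rejectionWordData (R x.1)).fits
      (fun _ ↦ LexSeq.index (ofLex (x.2.getD 0 default)).1)
      (ofLex (x.2.getD t default)).1 (ofLex (x.2.getD t default)).2) hfits
  exact (hball.comp (f := fun p ↦ (p, p.2.length)) (by fun_prop)).of_iff
    fun p ↦ WordData.valid_iff default p.2

end Computability

/-! ### `Σ⁰ₙ₊₃` predicates as finiteness of `Π⁰ₙ₊₁` sets -/

section FiniteSets

variable {α : Type u} [Primcodable α] {n : ℕ} {p : α → Prop}

lemma PiPred.exists_sigmaPred (hp : PiPred (n + 1) p) :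
    ∃ q : α × ℕ → Prop, SigmaPred n q ∧ ∀ a, p a ↔ ∀ y, q (a, y) :=
  let ⟨q, hq, hpq⟩ := hp
  ⟨fun x ↦ ¬ q x, hq, fun a ↦ by rw [← not_exists, ← hpq, not_not]⟩

/-- The list `b` witnesses `∃ k, ∀ y, r k y`, where `k` is its length: its entries are the least
counterexamples for the smaller numbers. This makes the witness unique. -/
def LeastCounterexamples (r : ℕ → ℕ → Prop) (b : List ℕ) : Prop :=
  (∀ y, r b.length y) ∧ ∀ k < b.length, ¬ r k (b.getD k 0) ∧ ∀ y < b.getD k 0, r k y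

namespace LeastCounterexamples

variable {r : ℕ → ℕ → Prop} {b b' : List ℕ}

lemma unique (h : LeastCounterexamples r b) (h' : LeastCounterexamples r b') : b = b' := by
  have hlength : b.length = b'.length := le_antisymm
    (not_lt.1 fun hlt ↦ (h.2 _ hlt).1 (h'.1 _)) (not_lt.1 fun hlt ↦ (h'.2 _ hlt).1 (h.1 _))
  refine List.ext_getElem hlength fun k hk hk' ↦ ?_
  have hbk := h.2 k hk
  have hbk' := h'.2 k hk'
  rw [List.getD_eq_getElem _ _ hk] at hbk
  rw [List.getD_eq_getElem _ _ hk'] at hbk'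
  exact le_antisymm (not_lt.1 fun hlt ↦ hbk'.1 (hbk.2 _ hlt))
    (not_lt.1 fun hlt ↦ hbk.1 (hbk'.2 _ hlt))

lemma exists_iff : (∃ b, LeastCounterexamples r b) ↔ ∃ k, ∀ y, r k y := by
  classical
  refine ⟨fun ⟨b, hb⟩ ↦ ⟨_, hb.1⟩, fun h ↦ ?_⟩
  have hcounter : ∀ k < Nat.find h, ∃ y, ¬ r k y ∧ ∀ y' < y, r k y' := fun k hk ↦
    have hex := not_forall.1 (Nat.find_min h hk)
    ⟨_, Nat.find_spec hex, fun _ hy ↦ not_not.1 (Nat.find_min hex hy)⟩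
  choose! f hf using hcounter
  refine ⟨(List.range (Nat.find h)).map f, ?_, fun k hk ↦ ?_⟩
  · simpa only [List.length_map, List.length_range] using Nat.find_spec h
  · rw [List.getD_eq_getElem _ _ hk, List.getElem_map, List.getElem_range]
    exact hf k (by simpa only [List.length_map, List.length_range] using hk)

end LeastCounterexamples

lemma piPred_leastCounterexamples {r : α → ℕ → ℕ → Prop}
    (hr : SigmaPred n fun x : (α × ℕ) × ℕ ↦ r x.1.1 x.1.2 x.2) :
    PiPred (n + 1) fun x : α × List ℕ ↦ LeastCounterexamples (r x.1) x.2 := by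
  have hr' := hr.toPi n.lt_succ_self
  refine .and (.forall ?_) (.forall (.imp ?_ (.and ?_ (.forall (.imp ?_ ?_)))))
  · exact hr'.comp (f := fun x : (α × List ℕ) × ℕ ↦ ((x.1.1, x.1.2.length), x.2)) (by fun_prop)
  · exact .of_computable (computablePred_lt (by fun_prop) (by fun_prop))
  · exact ((PiPred.not hr).mono n.le_succ).comp
      (f := fun x : (α × List ℕ) × ℕ ↦ ((x.1.1, x.2), x.1.2.getD x.2 0)) (by fun_prop)
  · exact .of_computable (computablePred_lt (by fun_prop) (by fun_prop))
  · exact hr'.comp (f := fun x : ((α × List ℕ) × ℕ) × ℕ ↦ ((x.1.1.1, x.1.2), x.2)) (by fun_prop)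

lemma SigmaPred.exists_unique_piPred_witness (hp : SigmaPred (n + 2) p) :
    ∃ P : α → List ℕ → Prop, PiPred (n + 1) (fun x : α × List ℕ ↦ P x.1 x.2) ∧
      (∀ a, p a ↔ ∃ b, P a b) ∧ ∀ a b b', P a b → P a b' → b = b' := by
  obtain ⟨q, hq, hpq⟩ := hp
  obtain ⟨r, hr, hqr⟩ := PiPred.exists_sigmaPred hq
  refine ⟨fun a ↦ LeastCounterexamples fun k y ↦ r ((a, k), y),
    piPred_leastCounterexamples (r := fun a k y ↦ r ((a, k), y)) hr, fun a ↦ ?_,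
    fun _ _ _ ↦ LeastCounterexamples.unique⟩
  rw [hpq, LeastCounterexamples.exists_iff]
  exact exists_congr fun k ↦ hqr (a, k)

lemma finite_setOf_forall_getD_iff {β : Type*} {P : ℕ → β → Prop}
    (hP : ∀ t b b', P t b → P t b' → b = b') (d : β) :
    {l : List β | ∀ t < l.length, P t (l.getD t d)}.Finite ↔ ∃ t, ∀ b, ¬ P t b := by
  constructor
  · contrapose!
    intro h
    choose f hf using h
    refine Set.infinite_of_injective_forall_mem (f := fun n ↦ (List.range n).map f)
      (fun n n' hn ↦ ?_) fun n t ht ↦ ?_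
    · simpa only [List.length_map, List.length_range] using congrArg List.length hn
    · rw [List.getD_eq_getElem _ _ ht, List.getElem_map, List.getElem_range]
      exact hf t
  · rintro ⟨t, ht⟩
    refine Set.Finite.of_finite_image (f := List.length) ((Set.finite_Iic t).subset ?_) ?_
    · rintro _ ⟨l, hl, rfl⟩
      exact not_lt.1 fun h ↦ ht _ (hl t h)
    · intro l hl l' hl' hlength
      refine List.ext_getElem hlength fun i hi hi' ↦ hP i _ _ ?_ ?_
      · exact List.getD_eq_getElem l d hi ▸ hl i hi
      · exact List.getD_eq_getElem l' d hi' ▸ hl' i hi'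

lemma SigmaPred.exists_piPred_finite_iff (hp : SigmaPred (n + 3) p) :
    ∃ N : α → List (List ℕ) → Prop, PiPred (n + 1) (fun x : α × List (List ℕ) ↦ N x.1 x.2) ∧
      ∀ a, p a ↔ {l | N a l}.Finite := by
  obtain ⟨q, hq, hpq⟩ := hp
  obtain ⟨P, hP, hqP, huniq⟩ := SigmaPred.exists_unique_piPred_witness hq
  refine ⟨fun a l ↦ ∀ t < l.length, P (a, t) (l.getD t []), .forall (.imp ?_ ?_), fun a ↦ ?_⟩
  · exact .of_computable (computablePred_lt (by fun_prop) (by fun_prop))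
  · exact hP.comp (f := fun x : (α × List (List ℕ)) × ℕ ↦ ((x.1.1, x.2), x.1.2.getD x.2 []))
      (by fun_prop)
  · rw [finite_setOf_forall_getD_iff (fun t ↦ huniq (a, t)), hpq]
    exact exists_congr fun t ↦ by rw [← not_exists, ← hqP, not_not]

end FiniteSets

/-! ### Reductions to the index sets -/

section Reductions

open Filter

variable {α β : Type*} [LinearOrder α] [LinearOrder β]

lemma hasSpExtension_empty_iff_of_orderIso (e : α ≃o β) :
    HasSpExtension (∅ : Set α) ↔ HasSpExtension (∅ : Set β) :=
  ⟨fun h ↦ Set.image_empty e ▸ h.image_orderIso e,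
    fun h ↦ Set.image_empty e.symm ▸ h.image_orderIso e.symm⟩

lemma exists_finset_hasSpExtension_of_orderIso (e : α ≃o β) :
    (∃ E : Finset α, HasSpExtension (E : Set α)) → ∃ E : Finset β, HasSpExtension (E : Set β) := by
  classical
  exact fun ⟨E, hE⟩ ↦ ⟨E.image e, Finset.coe_image (f := e) ▸ hE.image_orderIso e⟩

lemma mem_spHomogeneousIndices_iff_of_orderIso {e : ℕ} (he : IsOrderIndex e)
    (f : IndexedOrder e ≃o β) : e ∈ spHomogeneousIndices ↔ HasSpExtension (∅ : Set β) := by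
  rw [mem_spHomogeneousIndices_iff, and_iff_right he, isSpHomogeneous_iff,
    hasSpExtension_empty_iff_of_orderIso f]

lemma mem_weaklySpHomogeneousIndices_iff_of_orderIso {e : ℕ} (he : IsOrderIndex e)
    (f : IndexedOrder e ≃o β) :
    e ∈ weaklySpHomogeneousIndices ↔ ∃ E : Finset β, HasSpExtension (E : Set β) := by
  rw [mem_weaklySpHomogeneousIndices_iff, and_iff_right he, isWeaklySpHomogeneous_iff]
  exact ⟨exists_finset_hasSpExtension_of_orderIso f,
    exists_finset_hasSpExtension_of_orderIso f.symm⟩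

lemma SigmaPred.exists_forall_exists {α : Type u} [Primcodable α] {n : ℕ} {p : α → Prop}
    (hp : SigmaPred (n + 3) p) : ∃ q : ((α × ℕ) × ℕ) × ℕ → Prop,
      PiPred n q ∧ ∀ a, p a ↔ ∃ m, ∀ j, ∃ y, q (((a, m), j), y) := by
  obtain ⟨q₁, hq₁, hp⟩ := hp
  obtain ⟨q₂, ⟨q₃, hq₃, hq₂⟩, hq₁⟩ := PiPred.exists_sigmaPred hq₁
  exact ⟨q₃, hq₃, fun a ↦ by simp only [hp, hq₁, hq₂]⟩

lemma exists_reduction_of_frequently {T : ℕ → ℕ → Prop}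
    (hT : SigmaPred 4 fun x : ℕ × ℕ ↦ T x.1 x.2) (hfreq : ∀ x, ∃ᶠ i in atTop, T x i) :
    ∃ e : ℕ → ℕ, Computable e ∧ ∀ x, (e x ∈ spHomogeneousIndices ↔ ∀ i, T x i) ∧
      (e x ∈ weaklySpHomogeneousIndices ↔ ∀ᶠ i in atTop, T x i) := by
  obtain ⟨q, hq, hTq⟩ := hT.exists_forall_exists
  let R (x i m j y : ℕ) : Prop := ¬ q ((((x, i), m), j), y)
  have hR : SigmaPred 1 fun x : ℕ × ℕ × ℕ × ℕ × ℕ ↦ R x.1 x.2.1 x.2.2.1 x.2.2.2.1 x.2.2.2.2 :=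
    (SigmaPred.not hq).comp (f := fun x : ℕ × ℕ × ℕ × ℕ × ℕ ↦
      ((((x.1, x.2.1), x.2.2.1), x.2.2.2.1), x.2.2.2.2)) (by fun_prop)
  have hasOmega_iff (x i : ℕ) : (rejectionWordData (R x)).HasOmega i ↔ T x i := by
    rw [hasOmega_rejectionWordData_iff, hTq (x, i)]
    simp only [R, not_not]
  have hinf (x : ℕ) : {u | u ≠ [] ∧ (rejectionWordData (R x)).Valid LexSeq.index u}.Infinite :=
    have : Nonempty ((rejectionWordData (R x)).Words LexSeq.index) := ⟨WordData.base _ _ default⟩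
    Set.infinite_coe_iff.1
      (NoMaxOrder.infinite (α := (rejectionWordData (R x)).Words LexSeq.index))
  obtain ⟨e, he, hindex⟩ :=
    exists_index_of_suborder computablePred_word_le (sigmaPred_words hR) hinf
  refine ⟨e, he, fun x ↦ ?_⟩
  obtain ⟨hx, ⟨f⟩⟩ := hindex x
  have hfreq' : ∃ᶠ i in atTop, (rejectionWordData (R x)).HasOmega i := by
    simpa only [hasOmega_iff] using hfreq x
  rw [mem_spHomogeneousIndices_iff_of_orderIso hx f,
    mem_weaklySpHomogeneousIndices_iff_of_orderIso hx f,
    (rejectionSeparators (R x)).hasSpExtension_empty_iff hfreq',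
    (rejectionSeparators (R x)).exists_hasSpExtension_iff hfreq']
  simp only [hasOmega_iff, and_self]

lemma sigmaPred_forall_eq_imp {α : Type u} {β : Type v} [Primcodable α] [Primcodable β]
    [Inhabited β] {n : ℕ} {g : β → ℕ} (hg : Computable g) (hinj : Function.Injective g)
    {T : α → β → Prop} (hT : SigmaPred (n + 2) fun x : α × β ↦ T x.1 x.2) :
    SigmaPred (n + 2) fun x : α × ℕ ↦ ∀ b, g b = x.2 → T x.1 b := by
  have heq : ComputablePred fun x : (α × ℕ) × β ↦ g x.2 = x.1.2 :=
    computablePred_eq (by fun_prop) (by fun_prop)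
  refine SigmaPred.of_iff (p := fun x ↦ (∀ b, ¬ g b = x.2) ∨ ∃ b, g b = x.2 ∧ T x.1 b)
    (.or (PiPred.toSigma (n := 1) (.forall (.of_computable heq.not)) (by lia))
      (.exists (.and (.of_computable heq)
        (hT.comp (f := fun x : (α × ℕ) × β ↦ (x.1.1, x.2)) (by fun_prop))))) fun x ↦ ?_
  constructor
  · intro h
    by_cases hx : ∃ b, g b = x.2
    · exact .inr (hx.imp fun b hb ↦ ⟨hb, h b hb⟩)
    · exact .inl (not_exists.1 hx)
  · rintro (h | ⟨b, hb, hTb⟩) b' hb'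
    · exact absurd hb' (h b')
    · rwa [hinj (hb'.trans hb.symm)]

lemma exists_reduction {β : Type v} [Primcodable β] [Inhabited β] {T : ℕ → β → Prop}
    (hT : SigmaPred 4 fun x : ℕ × β ↦ T x.1 x.2) :
    ∃ e : ℕ → ℕ, Computable e ∧ ∀ x, (e x ∈ spHomogeneousIndices ↔ ∀ b, T x b) ∧
      (e x ∈ weaklySpHomogeneousIndices ↔ {b | ¬ T x b}.Finite) := by
  -- No even number is a value of `g`, so the transferred predicate holds infinitely often.
  let g (b : β) : ℕ := Encodable.encode b + Encodable.encode b + 1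
  have hinj : Function.Injective g := fun b b' h ↦ Encodable.encode_injective (by lia)
  obtain ⟨e, he, hreduction⟩ := exists_reduction_of_frequently
    (T := fun x i ↦ ∀ b, g b = i → T x b) (sigmaPred_forall_eq_imp (by fun_prop) hinj hT)
    fun x ↦ frequently_atTop.2 fun i ↦ ⟨i + i, by lia, fun b hb ↦ by lia⟩
  refine ⟨e, he, fun x ↦ ⟨(hreduction x).1.trans
    ⟨fun h b ↦ h _ b rfl, fun h _ b _ ↦ h b⟩, ?_⟩⟩
  have himage : {i | ¬ ∀ b, g b = i → T x b} = g '' {b | ¬ T x b} := by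
    ext i
    simp only [Set.mem_image, Set.mem_ofPred_eq, not_forall, exists_prop, and_comm]
  rw [(hreduction x).2, ← Nat.cofinite_eq_atTop, eventually_cofinite, himage,
    Set.finite_image_iff hinj.injOn]

lemma manyOneReducible_spHomogeneousIndices {A : Set ℕ} (hA : IsPiZero 5 A) :
    (fun x ↦ x ∈ A) ≤₀ fun x ↦ x ∈ spHomogeneousIndices := by
  obtain ⟨q, hq, hAq⟩ := (isPiZero_iff.1 hA).exists_sigmaPred
  obtain ⟨e, he, hreduction⟩ := exists_reduction (T := fun x i ↦ q (x, i)) hq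
  exact ⟨e, he, fun x ↦ (hAq x).trans (hreduction x).1.symm⟩

lemma manyOneReducible_weaklySpHomogeneousIndices {A : Set ℕ} (hA : IsSigmaZero 6 A) :
    (fun x ↦ x ∈ A) ≤₀ fun x ↦ x ∈ weaklySpHomogeneousIndices := by
  obtain ⟨N, hN, hAN⟩ := (isSigmaZero_iff.1 hA).exists_piPred_finite_iff
  obtain ⟨e, he, hreduction⟩ := exists_reduction (T := fun x l ↦ ¬ N x l) hN
  refine ⟨e, he, fun x ↦ (hAN x).trans ?_⟩
  simpa only [not_not] using (hreduction x).2.symm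

end Reductions

theorem mainTheorem3 :
    IsCompleteFor (IsPiZero 5) spHomogeneousIndices ∧
      IsCompleteFor (IsSigmaZero 6) weaklySpHomogeneousIndices :=
  ⟨⟨isPiZero_spHomogeneousIndices, fun _ ↦ manyOneReducible_spHomogeneousIndices⟩,
    ⟨isSigmaZero_weaklySpHomogeneousIndices, fun _ ↦ manyOneReducible_weaklySpHomogeneousIndices⟩⟩
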